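/- Let $k$ be a finite field with $q$ elements and let $\mathcal C$ be a $k$-linear triangulated category with shift functor $[1]$ such that 1. $\operatorname{Hom}(X,Y)$ is a finite-dimensional $k$-vector space for all $X,Y\in\mathcal C$; 2. the endomorphism ring of every indecomposable object is local; 3. $\sum_{i\in\mathbb Z}\dim_k\operatorname{Hom}(X[i],Y)<\infty$ for all $X,Y\in\mathcal C$. Write $[X]$ both for the isomorphism class of $X$ and for its image in the Grothendieck group $K(\mathcal C)$. Let $\langle-,-\rangle:K(\mathcal C)\times K(\mathcal C)\to\mathbb Z$ be the bilinear form with $\langle[X],[Y]\rangle=\sum_{i\in\mathbb Z}(-1)^i\dim_k\operatorname{Hom}(X,Y[i])$, and put $(\alpha,\beta)=\langle\alpha,\beta\rangle+\langle\beta,\alpha\rangle$. For objects $X,Y,L$ let $\{X,Y\}=\prod_{i>0}|\operatorname{Hom}(X[i],Y)|^{(-1)^i}$, let $\operatorname{Hom}(X,L)_Y$ be the set of morphisms $X\to L$ whose mapping cone is isomorphic to $Y$, and let $$F_{XY}^L=\frac{|\operatorname{Hom}(X,L)_Y|}{|\operatorname{Aut}X|}\cdot\frac{\{X,L\}}{\{X,X\}}\in\mathbb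 Q .$$ For fixed $X,Y$ only finitely many classes $[L]$ have $F_{XY}^L\neq0$. Let $v=\sqrt q$. The extended twisted derived Hall algebra $\mathcal H_{et}(\mathcal C)$ is the $\mathbb Q(v)$-vector space with basis $\{K_\alpha u_{[X]}\mid\alpha\in K(\mathcal C),\ X\in\mathcal C\}$ (with $X$ up to isomorphism), with the $\mathbb Q(v)$-bilinear multiplication determined by $$(K_\alpha u_{[X]})\circ(K_\beta u_{[Y]})=v^{\langle[X],[Y]\rangle-(\beta,[X])}\sum_{[L]}F_{XY}^L\,K_{\alpha+\beta}u_{[L]} .$$ **Proposition.** The algebra $\mathcal H_{et}(\mathcal C)$ is associative, and $K_0u_{[0]}$ is its two-sided unit. -/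

import Mathlib

open CategoryTheory CategoryTheory.Limits CategoryTheory.Pretriangulated
open scoped ZeroObject

namespace DerivedHall

/-! ### Alternating sums of dimensions along a long exact sequence -/

section Euler

variable {k : Type*} [Field k]

/-- The alternating sum of the dimensions of a family of vector spaces indexed by the integers. -/
noncomputable def altDim (k : Type*) [Field k] (A : ℤ → Type*)
    [∀ i, AddCommGroup (A i)] [∀ i, Module k (A i)] : ℤ :=
  ∑ᶠ i : ℤ, (i.negOnePow : ℤ) * (Module.finrank k (A i) : ℤ)

theorem exact_of_eq {A B D : Type*} [Zero D] {f f' : A → B} {g g' : B → D}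
    (h : Function.Exact f g) (hf : ∀ x, f x = f' x) (hg : ∀ x, g x = g' x) :
    Function.Exact f' g' := by
  rwa [← funext hf, ← funext hg]

theorem finsum_negOnePow_succ (r : ℤ → ℤ) :
    ∑ᶠ i : ℤ, (i.negOnePow : ℤ) * r (i + 1) = -∑ᶠ i : ℤ, (i.negOnePow : ℤ) * r i := by
  have h := finsum_comp_equiv (Equiv.addRight (1 : ℤ)) (f := fun i : ℤ => (i.negOnePow : ℤ) * r i)
  rw [← h, ← finsum_neg_distrib]
  refine finsum_congr fun i => ?_
  simp [Int.negOnePow_succ]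

theorem altDim_exact {A B D : ℤ → Type*}
    [∀ i, AddCommGroup (A i)] [∀ i, Module k (A i)]
    [∀ i, AddCommGroup (B i)] [∀ i, Module k (B i)]
    [∀ i, AddCommGroup (D i)] [∀ i, Module k (D i)]
    [∀ i, Module.Finite k (A i)] [∀ i, Module.Finite k (B i)] [∀ i, Module.Finite k (D i)]
    (hA : {i : ℤ | Nontrivial (A i)}.Finite) (hD : {i : ℤ | Nontrivial (D i)}.Finite)
    (f : ∀ i, A i →ₗ[k] B i) (g : ∀ i, B i →ₗ[k] D i) (d : ∀ i, D i →ₗ[k] A (i + 1))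
    (hfg : ∀ i, Function.Exact (f i) (g i)) (hgd : ∀ i, Function.Exact (g i) (d i))
    (hdf : ∀ i, Function.Exact (d i) (f (i + 1))) :
    altDim k B = altDim k A + altDim k D := by
  let rf : ℤ → ℤ := fun i => (Module.finrank k (LinearMap.range (f i)) : ℤ)
  let rg : ℤ → ℤ := fun i => (Module.finrank k (LinearMap.range (g i)) : ℤ)
  let rd : ℤ → ℤ := fun i => (Module.finrank k (LinearMap.range (d i)) : ℤ)
  have eB : ∀ i, (Module.finrank k (B i) : ℤ) = rf i + rg i := by
    intro i
    have h := LinearMap.finrank_range_add_finrank_ker (g i)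
    rw [LinearMap.exact_iff.mp (hfg i)] at h
    simp only [rf, rg]; omega
  have eD : ∀ i, (Module.finrank k (D i) : ℤ) = rg i + rd i := by
    intro i
    have h := LinearMap.finrank_range_add_finrank_ker (d i)
    rw [LinearMap.exact_iff.mp (hgd i)] at h
    simp only [rd, rg]; omega
  have eA : ∀ i, (Module.finrank k (A (i + 1)) : ℤ) = rd i + rf (i + 1) := by
    intro i
    have h := LinearMap.finrank_range_add_finrank_ker (f (i + 1))
    rw [LinearMap.exact_iff.mp (hdf i)] at h
    simp only [rf, rd]; omega
  have sf : (Function.support fun i : ℤ => (i.negOnePow : ℤ) * rf i).Finite := by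
    refine hA.subset fun i hi => ?_
    have h1 : Module.finrank k (LinearMap.range (f i)) ≠ 0 := by
      intro h0; exact hi (by simp [rf, h0])
    have h2 := LinearMap.finrank_range_le (f i)
    exact Module.nontrivial_of_finrank_pos (R := k) (M := A i) (by omega)
  have sd : (Function.support fun i : ℤ => (i.negOnePow : ℤ) * rd i).Finite := by
    refine hD.subset fun i hi => ?_
    have h1 : Module.finrank k (LinearMap.range (d i)) ≠ 0 := by
      intro h0; exact hi (by simp [rd, h0])
    have h2 := LinearMap.finrank_range_le (d i)
    exact Module.nontrivial_of_finrank_pos (R := k) (M := D i) (by omega)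
  have sg : (Function.support fun i : ℤ => (i.negOnePow : ℤ) * rg i).Finite := by
    refine hD.subset fun i hi => ?_
    have h1 : Module.finrank k (LinearMap.range (g i)) ≠ 0 := by
      intro h0; exact hi (by simp [rg, h0])
    have h2 := Submodule.finrank_le (LinearMap.range (g i))
    exact Module.nontrivial_of_finrank_pos (R := k) (M := D i) (by omega)
  have sf' : (Function.support fun i : ℤ => (i.negOnePow : ℤ) * rf (i + 1)).Finite := by
    refine (sf.preimage (f := fun i : ℤ => i + 1) (add_left_injective 1).injOn).subset ?_
    intro i hi
    simpa [Int.negOnePow_succ] using hi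
  have tB : altDim k B = (∑ᶠ i : ℤ, (i.negOnePow : ℤ) * rf i)
      + ∑ᶠ i : ℤ, (i.negOnePow : ℤ) * rg i := by
    rw [altDim, ← finsum_add_distrib sf sg]
    exact finsum_congr fun i => by rw [eB, mul_add]
  have tD : altDim k D = (∑ᶠ i : ℤ, (i.negOnePow : ℤ) * rg i)
      + ∑ᶠ i : ℤ, (i.negOnePow : ℤ) * rd i := by
    rw [altDim, ← finsum_add_distrib sg sd]
    exact finsum_congr fun i => by rw [eD, mul_add]
  have tA : -altDim k A = (∑ᶠ i : ℤ, (i.negOnePow : ℤ) * rd i)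
      + -∑ᶠ i : ℤ, (i.negOnePow : ℤ) * rf i := by
    rw [altDim, ← finsum_negOnePow_succ (fun i => (Module.finrank k (A i) : ℤ)),
      ← finsum_negOnePow_succ rf, ← finsum_add_distrib sd sf']
    exact finsum_congr fun i => by rw [eA, mul_add]
  linarith

end Euler

universe w u

/-! ### Homologically finite triangulated categories -/

/-- The finiteness conditions on a `k`-linear triangulated category: finite-dimensional morphism
spaces, local endomorphism rings of indecomposable objects, and, for all `X`, `Y`, only finitely
many integers `i` with `Hom(X[i], Y) ≠ 0`
(which, given the first condition, says that `∑ i, dim Hom(X[i], Y)` is finite). -/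
class HomologicallyFinite (k : Type*) [Field k] (C : Type u) [Category.{w} C] [Preadditive C]
    [Linear k C] [HasZeroObject C] [HasShift C ℤ] [∀ n : ℤ, (shiftFunctor C n).Additive]
    [Pretriangulated C] : Prop where
  finite_hom : ∀ X Y : C, Module.Finite k (X ⟶ Y)
  isLocalRing_end : ∀ X : C, Indecomposable X → IsLocalRing (End X)
  finite_shifts : ∀ X Y : C, {i : ℤ | Nontrivial (X⟦i⟧ ⟶ Y)}.Finite

theorem finite_shifts_right (k : Type*) [Field k] {C : Type u} [Category.{w} C] [Preadditive C]
    [Linear k C] [HasZeroObject C] [HasShift C ℤ] [∀ n : ℤ, (shiftFunctor C n).Additive]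
    [Pretriangulated C] [HomologicallyFinite k C] (X Y : C) :
    {i : ℤ | Nontrivial (X ⟶ Y⟦i⟧)}.Finite := by
  refine ((HomologicallyFinite.finite_shifts k X Y).preimage
    (f := fun i : ℤ => -i) neg_injective.injOn).subset ?_
  intro i hi
  have e : (X ⟶ Y⟦i⟧) ≃ (X⟦-i⟧ ⟶ Y) :=
    ((shiftEquiv' C (-i) i (by simp)).toAdjunction.homEquiv X Y).symm
  have : Nontrivial (X ⟶ Y⟦i⟧) := hi
  exact e.symm.nontrivial

/-! ### Isomorphism classes and the Grothendieck group -/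

/-- The isomorphism classes of objects. -/
abbrev IsoClass (C : Type u) [Category.{w} C] : Type u := Quotient (isIsomorphicSetoid C)

/-- The isomorphism class of an object. -/
abbrev isoClass {C : Type u} [Category.{w} C] (X : C) : IsoClass C :=
  Quotient.mk (isIsomorphicSetoid C) X

section

variable (k : Type*) [Field k] (C : Type u) [Category.{w} C] [Preadditive C]
  [Linear k C] [HasZeroObject C] [HasShift C ℤ] [∀ n : ℤ, (shiftFunctor C n).Additive]
  [Pretriangulated C]

/-- The relations `[Y] - [X] - [Z]`, one for each distinguished triangle `X ⟶ Y ⟶ Z ⟶ X[1]`. -/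
def k0Relations : AddSubgroup (FreeAbelianGroup C) :=
  AddSubgroup.closure {x | ∃ T ∈ distTriang C,
    x = FreeAbelianGroup.of T.obj₂ - FreeAbelianGroup.of T.obj₁ - FreeAbelianGroup.of T.obj₃}

/-- The Grothendieck group of a triangulated category. -/
abbrev K0 : Type u := FreeAbelianGroup C ⧸ k0Relations C

variable {C}

/-- The class of an object in the Grothendieck group. -/
def k0Class (X : C) : K0 C := QuotientAddGroup.mk (FreeAbelianGroup.of X)

theorem k0Class_triangle (T : Triangle C) (hT : T ∈ distTriang C) :
    k0Class T.obj₂ = k0Class T.obj₁ + k0Class T.obj₃ := by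
  have h : FreeAbelianGroup.of T.obj₂ - FreeAbelianGroup.of T.obj₁ - FreeAbelianGroup.of T.obj₃
      ∈ k0Relations C := AddSubgroup.subset_closure ⟨T, hT, rfl⟩
  have h' := (QuotientAddGroup.eq_zero_iff _).mpr h
  have h'' : k0Class T.obj₂ - k0Class T.obj₁ - k0Class T.obj₃ = 0 := h'
  rw [sub_sub, sub_eq_zero] at h''
  exact h''

theorem k0Class_zero : k0Class (0 : C) = 0 := by
  have h := k0Class_triangle _ (contractible_distinguished (0 : C))
  simpa using h

theorem k0Class_iso {X Y : C} (e : X ≅ Y) : k0Class X = k0Class Y := by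
  have hT : Triangle.mk e.hom (0 : Y ⟶ 0) 0 ∈ distTriang C :=
    isomorphic_distinguished _ (contractible_distinguished X) _
      (Triangle.isoMk _ _ (Iso.refl X) e.symm (Iso.refl (0 : C))
        (by change e.hom ≫ e.inv = 𝟙 X ≫ 𝟙 X; simp)
        (by change (0 : Y ⟶ 0) ≫ 𝟙 0 = e.inv ≫ 0; simp)
        (by change (0 : 0 ⟶ X⟦(1 : ℤ)⟧) ≫ (𝟙 X)⟦(1 : ℤ)⟧' = 𝟙 (0 : C) ≫ 0; simp))
  have h := k0Class_triangle _ hT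
  simp only [Triangle.mk_obj₁, Triangle.mk_obj₂, Triangle.mk_obj₃, k0Class_zero, add_zero] at h
  exact h.symm

/-- The class in the Grothendieck group of an isomorphism class of objects. -/
def IsoClass.toK0 (x : IsoClass C) : K0 C :=
  Quotient.lift k0Class (fun _ _ (h : IsIsomorphic _ _) => h.elim fun e => k0Class_iso e) x

/-! ### The Euler form -/

/-- `χ(X, Y) = ∑ i, (-1) ^ i * dim Hom(X, Y[i])`, a sum over all integers `i`. -/
noncomputable def eulerChar (X Y : C) : ℤ := altDim k (fun i : ℤ => X ⟶ Y⟦i⟧)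

variable [HomologicallyFinite k C]

theorem eulerChar_triangle_right (X : C) (T : Triangle C) (hT : T ∈ distTriang C) :
    eulerChar k X T.obj₂ = eulerChar k X T.obj₁ + eulerChar k X T.obj₃ := by
  have : ∀ X Y : C, Module.Finite k (X ⟶ Y) := HomologicallyFinite.finite_hom
  let F := preadditiveCoyoneda.obj (Opposite.op X)
  refine altDim_exact (k := k) (finite_shifts_right k X _) (finite_shifts_right k X _)
    (fun i => Linear.rightComp k X (T.mor₁⟦i⟧'))
    (fun i => Linear.rightComp k X (T.mor₂⟦i⟧'))
    (fun i => Linear.rightComp k X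
      (T.mor₃⟦i⟧' ≫ (shiftFunctorAdd' C 1 i (i + 1) (by lia)).inv.app _)) ?_ ?_ ?_
  · intro i
    exact (ShortComplex.ab_exact_iff_function_exact _).mp (F.homologySequence_exact₂ T hT i)
  · intro i
    exact exact_of_eq ((ShortComplex.ab_exact_iff_function_exact _).mp
      (F.homologySequence_exact₃ T hT i (i + 1) rfl)) (fun _ => rfl)
      (fun x => preadditiveCoyoneda_homologySequenceδ_apply T i (i + 1) rfl x)
  · intro i
    exact exact_of_eq ((ShortComplex.ab_exact_iff_function_exact _).mp
      (F.homologySequence_exact₁ T hT i (i + 1) rfl))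
      (fun x => preadditiveCoyoneda_homologySequenceδ_apply T i (i + 1) rfl x) (fun _ => rfl)

open Pretriangulated.Opposite in
theorem eulerChar_triangle_left [∀ n : ℤ, Functor.Linear k (shiftFunctor C n)]
    (Y : C) (T : Triangle C) (hT : T ∈ distTriang C) :
    eulerChar k T.obj₂ Y = eulerChar k T.obj₁ Y + eulerChar k T.obj₃ Y := by
  have : ∀ X Y : C, Module.Finite k (X ⟶ Y) := HomologicallyFinite.finite_hom
  let F := preadditiveYoneda.obj Y
  have hT' := op_distinguished T hT
  rw [add_comm]
  refine altDim_exact (k := k) (finite_shifts_right k _ Y) (finite_shifts_right k _ Y)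
    (fun i => Linear.leftComp k (Y⟦i⟧) T.mor₂)
    (fun i => Linear.leftComp k (Y⟦i⟧) T.mor₁)
    (fun i => (Linear.leftComp k _ T.mor₃) ∘ₗ
      (Linear.rightComp k _ ((shiftFunctorAdd' C i 1 (i + 1) rfl).inv.app Y)) ∘ₗ
      (Functor.mapLinearMap k (shiftFunctor C (1 : ℤ)))) ?_ ?_ ?_
  · intro i
    exact (ShortComplex.ab_exact_iff_function_exact _).mp (F.homologySequence_exact₂ _ hT' i)
  · intro i
    exact exact_of_eq ((ShortComplex.ab_exact_iff_function_exact _).mp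
      (F.homologySequence_exact₃ _ hT' i (i + 1) rfl)) (fun _ => rfl)
      (fun x => preadditiveYoneda_homologySequenceδ_apply T i (i + 1) rfl x)
  · intro i
    exact exact_of_eq ((ShortComplex.ab_exact_iff_function_exact _).mp
      (F.homologySequence_exact₁ _ hT' i (i + 1) rfl))
      (fun x => preadditiveYoneda_homologySequenceδ_apply T i (i + 1) rfl x) (fun _ => rfl)

/-- The additive map on the Grothendieck group that sends `[Y]` to `χ(X, Y)`. -/
noncomputable def eulerFormRight (X : C) : K0 C →+ ℤ :=
  QuotientAddGroup.lift (k0Relations C) (FreeAbelianGroup.lift fun Y : C => eulerChar k X Y)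
    (by
      refine (AddSubgroup.closure_le (AddMonoidHom.ker _)).mpr ?_
      rintro _ ⟨T, hT, rfl⟩
      simp [eulerChar_triangle_right k X T hT])

theorem eulerFormRight_k0Class (X Y : C) :
    eulerFormRight k X (k0Class Y) = eulerChar k X Y :=
  FreeAbelianGroup.lift_apply_of _ _

variable (C) in
/-- The Euler form `⟨α, β⟩` on the Grothendieck group, a biadditive map that sends
`([X], [Y])` to `χ(X, Y)`. -/
noncomputable def eulerForm [∀ n : ℤ, Functor.Linear k (shiftFunctor C n)] :
    K0 C →+ K0 C →+ ℤ :=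
  QuotientAddGroup.lift (k0Relations C)
    (FreeAbelianGroup.lift fun X : C => eulerFormRight k X)
    (by
      refine (AddSubgroup.closure_le (AddMonoidHom.ker _)).mpr ?_
      rintro _ ⟨T, hT, rfl⟩
      refine QuotientAddGroup.addMonoidHom_ext _ (FreeAbelianGroup.lift_ext _ _ fun Y => ?_)
      have h (X : C) : eulerFormRight k X ↑(FreeAbelianGroup.of Y) = eulerChar k X Y :=
        eulerFormRight_k0Class k X Y
      simp [h, eulerChar_triangle_left k Y T hT])

theorem eulerForm_k0Class [∀ n : ℤ, Functor.Linear k (shiftFunctor C n)] (X Y : C) :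
    eulerForm k C (k0Class X) (k0Class Y) = eulerChar k X Y := by
  have h : eulerForm k C (k0Class X) = eulerFormRight k X := FreeAbelianGroup.lift_apply_of _ _
  rw [h, eulerFormRight_k0Class]

variable (C) in
/-- The symmetrized Euler form `(α, β) = ⟨α, β⟩ + ⟨β, α⟩`. -/
noncomputable def symEulerForm [∀ n : ℤ, Functor.Linear k (shiftFunctor C n)] (a b : K0 C) : ℤ :=
  eulerForm k C a b + eulerForm k C b a

end

/-! ### The structure constants of the derived Hall algebra -/

section

variable {C : Type u} [Category.{w} C] [HasShift C ℤ]

/-- `{X, Y} = ∏ |Hom(X[i], Y)| ^ ((-1) ^ i)`, the product being over all integers `i > 0`,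
written as `i = n + 1` with `n` a natural number. -/
noncomputable def shiftProd (X Y : C) : ℚ :=
  ∏ᶠ n : ℕ, (Nat.card (X⟦(n : ℤ) + 1⟧ ⟶ Y) : ℚ) ^ ((-1 : ℤ) ^ (n + 1))

theorem shiftProd_iso {X X' Y Y' : C} (eX : X ≅ X') (eY : Y ≅ Y') :
    shiftProd X Y = shiftProd X' Y' := by
  refine finprod_congr fun n => ?_
  rw [Nat.card_congr (((shiftFunctor C ((n : ℤ) + 1)).mapIso eX).homCongr eY)]

end

section

variable {C : Type u} [Category.{w} C] [Preadditive C] [HasZeroObject C] [HasShift C ℤ]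
  [∀ n : ℤ, (shiftFunctor C n).Additive] [Pretriangulated C]

/-- `Hom(X, L)_Y`: the morphisms `X ⟶ L` whose mapping cone is isomorphic to `Y`. -/
def homWithCone (X L Y : C) : Set (X ⟶ L) :=
  {f | ∃ (g : L ⟶ Y) (h : Y ⟶ X⟦(1 : ℤ)⟧), Triangle.mk f g h ∈ distTriang C}

/-- The derived Hall number `F_{XY}^L = |Hom(X, L)_Y| / |Aut X| * {X, L} / {X, X}`. -/
noncomputable def hallNumber (X Y L : C) : ℚ :=
  (Nat.card (homWithCone X L Y) : ℚ) / Nat.card (Aut X) * (shiftProd X L / shiftProd X X)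

theorem homWithCone_iso {X X' L L' Y Y' : C} (eX : X ≅ X') (eL : L ≅ L') (eY : Y ≅ Y')
    {f : X ⟶ L} (hf : f ∈ homWithCone X L Y) :
    eX.homCongr eL f ∈ homWithCone X' L' Y' := by
  obtain ⟨g, h, hT⟩ := hf
  refine ⟨eL.homCongr eY g, eY.homCongr ((shiftFunctor C (1 : ℤ)).mapIso eX) h, ?_⟩
  refine isomorphic_distinguished _ hT _ (Triangle.isoMk _ _ eX.symm eL.symm eY.symm ?_ ?_ ?_)
  · change (eX.inv ≫ f ≫ eL.hom) ≫ eL.inv = eX.inv ≫ f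
    simp
  · change (eL.inv ≫ g ≫ eY.hom) ≫ eY.inv = eL.inv ≫ g
    simp
  · change (eY.inv ≫ h ≫ eX.hom⟦(1 : ℤ)⟧') ≫ eX.inv⟦(1 : ℤ)⟧' = eY.inv ≫ h
    simp [← Functor.map_comp]

theorem hallNumber_iso {X X' Y Y' L L' : C} (eX : X ≅ X') (eY : Y ≅ Y') (eL : L ≅ L') :
    hallNumber X Y L = hallNumber X' Y' L' := by
  have h1 : Nat.card (homWithCone X L Y) = Nat.card (homWithCone X' L' Y') := by
    refine Nat.card_congr ((eX.homCongr eL).subtypeEquiv fun f => ?_)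
    refine ⟨homWithCone_iso eX eL eY, fun h => ?_⟩
    have h' := homWithCone_iso eX.symm eL.symm eY.symm h
    simpa using h'
  have h2 : Nat.card (Aut X) = Nat.card (Aut X') :=
    Nat.card_congr (Aut.autMulEquivOfIso eX).toEquiv
  rw [hallNumber, hallNumber, h1, h2, shiftProd_iso eX eL, shiftProd_iso eX eX]

/-- The derived Hall number as a function of isomorphism classes. -/
noncomputable def hallCoeff (x y l : IsoClass C) : ℚ :=
  Quotient.liftOn x
    (fun X => Quotient.liftOn₂ y l (fun Y L => hallNumber X Y L)
      (fun _ _ _ _ (hY : IsIsomorphic _ _) (hL : IsIsomorphic _ _) =>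
        hY.elim fun eY => hL.elim fun eL => hallNumber_iso (Iso.refl X) eY eL))
    (fun X X' (hX : IsIsomorphic X X') => hX.elim fun eX =>
      Quotient.inductionOn₂ y l fun Y L => hallNumber_iso eX (Iso.refl Y) (Iso.refl L))

theorem hallCoeff_isoClass (X Y L : C) :
    hallCoeff (isoClass X) (isoClass Y) (isoClass L) = hallNumber X Y L := rfl

/-- The middle term of a triangle `X ⟶ L ⟶ Y ⟶ X[1]` is determined by the map `Y ⟶ X[1]`. -/
theorem iso_of_same_mor₃ {X Y L L' : C} {f : X ⟶ L} {g : L ⟶ Y} {f' : X ⟶ L'} {g' : L' ⟶ Y}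
    {h : Y ⟶ X⟦(1 : ℤ)⟧} (hT : Triangle.mk f g h ∈ distTriang C)
    (hT' : Triangle.mk f' g' h ∈ distTriang C) : Nonempty (L ≅ L') := by
  have e : h ≫ (𝟙 X)⟦(1 : ℤ)⟧' = 𝟙 Y ≫ h := by
    rw [CategoryTheory.Functor.map_id, Category.comp_id, Category.id_comp]
  obtain ⟨b, hb₁, hb₂⟩ := complete_distinguished_triangle_morphism₂ _ _ hT hT' (𝟙 X) (𝟙 Y) e
  let φ : Triangle.mk f g h ⟶ Triangle.mk f' g' h :=
    { hom₁ := 𝟙 X, hom₂ := b, hom₃ := 𝟙 Y, comm₁ := hb₁, comm₂ := hb₂, comm₃ := e }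
  have hb : IsIso b := isIso₂_of_isIso₁₃ φ hT hT' (inferInstanceAs (IsIso (𝟙 X)))
    (inferInstanceAs (IsIso (𝟙 Y)))
  exact ⟨@asIso C _ L L' b hb⟩

end

/-- For given `x`, `y`, only finitely many derived Hall numbers are nonzero. -/
theorem hallCoeff_support_finite (k : Type*) [Field k] [Finite k] {C : Type u} [Category.{w} C]
    [Preadditive C] [Linear k C] [HasZeroObject C] [HasShift C ℤ]
    [∀ n : ℤ, (shiftFunctor C n).Additive] [Pretriangulated C] [HomologicallyFinite k C]
    (x y : IsoClass C) : (Function.support (hallCoeff x y)).Finite := by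
  induction x, y using Quotient.inductionOn₂ with | _ X Y => ?_
  have : Module.Finite k (Y ⟶ X⟦(1 : ℤ)⟧) := HomologicallyFinite.finite_hom _ _
  have : Finite (Y ⟶ X⟦(1 : ℤ)⟧) := Module.finite_of_finite k
  choose M a b hM using fun h : Y ⟶ X⟦(1 : ℤ)⟧ => distinguished_cocone_triangle₂ h
  refine (Set.finite_range fun h => isoClass (M h)).subset ?_
  intro l hl
  induction l using Quotient.inductionOn with | _ L => ?_
  have hne : hallNumber X Y L ≠ 0 := hl
  have h1 : Nat.card (homWithCone X L Y) ≠ 0 := by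
    intro h0; exact hne (by simp [hallNumber, h0])
  obtain ⟨⟨f, g, h, hT⟩⟩ := (Nat.card_ne_zero.mp h1).1
  exact ⟨h, Quotient.sound (iso_of_same_mor₃ (hM h) hT)⟩

/-! ### The extended twisted derived Hall algebra -/

/-- The field `ℚ(v)` with `v = √q`, where `q` is the number of elements of `k`. -/
abbrev Qv (k : Type*) : Type :=
  IntermediateField.adjoin ℚ {Real.sqrt (Nat.card k)}

/-- The element `v = √q` of `ℚ(v)`. -/
noncomputable def Qv.v (k : Type*) : Qv k :=
  ⟨Real.sqrt (Nat.card k), IntermediateField.mem_adjoin_simple_self ℚ _⟩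

/-- The vector space over `ℚ(v)` with basis `K_α u_x`, where `α` runs over the Grothendieck group
and `x` over the isomorphism classes of objects. -/
def Het (k : Type*) (C : Type u) [Category.{w} C] [Preadditive C] [HasZeroObject C]
    [HasShift C ℤ] [∀ n : ℤ, (shiftFunctor C n).Additive] [Pretriangulated C] : Type u :=
  (K0 C × IsoClass C) →₀ Qv k

namespace Het

section

variable (k : Type*) (C : Type u) [Category.{w} C] [Preadditive C] [HasZeroObject C]
  [HasShift C ℤ] [∀ n : ℤ, (shiftFunctor C n).Additive] [Pretriangulated C]

noncomputable instance : AddCommGroup (Het k C) :=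
  inferInstanceAs (AddCommGroup ((K0 C × IsoClass C) →₀ Qv k))

noncomputable instance : Module (Qv k) (Het k C) :=
  inferInstanceAs (Module (Qv k) ((K0 C × IsoClass C) →₀ Qv k))

/-- The basis of the elements `K_α u_x`. -/
noncomputable def basis : Module.Basis (K0 C × IsoClass C) (Qv k) (Het k C) :=
  Module.Basis.ofRepr (LinearEquiv.refl (Qv k) ((K0 C × IsoClass C) →₀ Qv k))

variable {C}

/-- The basis element `K_α u_x`. -/
noncomputable def Ku (α : K0 C) (x : IsoClass C) : Het k C := basis k C (α, x)

end

variable (k : Type*) [Field k] [Finite k] (C : Type u) [Category.{w} C] [Preadditive C]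
  [Linear k C] [HasZeroObject C] [HasShift C ℤ] [∀ n : ℤ, (shiftFunctor C n).Additive]
  [∀ n : ℤ, Functor.Linear k (shiftFunctor C n)] [Pretriangulated C] [HomologicallyFinite k C]

variable {C} in
/-- `K_γ (u_x · u_y) = ∑ l, F_{xy}^l K_γ u_l`. -/
noncomputable def hallProduct (γ : K0 C) (x y : IsoClass C) : Het k C :=
  ∑ l ∈ (hallCoeff_support_finite k x y).toFinset,
    algebraMap ℚ (Qv k) (hallCoeff x y l) • Ku k γ l

/-- The multiplication: the bilinear map such that `K_α u_x ∘ K_β u_y` is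
`v ^ (⟨x, y⟩ - (β, x)) K_{α + β} (u_x · u_y)`. -/
noncomputable def mulMap : Het k C →ₗ[Qv k] Het k C →ₗ[Qv k] Het k C :=
  (basis k C).constr (Qv k) fun a => (basis k C).constr (Qv k) fun b =>
    Qv.v k ^ (eulerForm k C a.2.toK0 b.2.toK0 - symEulerForm k C b.1 a.2.toK0) •
      hallProduct k (a.1 + b.1) a.2 b.2

noncomputable instance : Mul (Het k C) := ⟨fun a b => mulMap k C a b⟩

variable {C}

theorem mul_def (a b : Het k C) : a * b = mulMap k C a b := rfl

theorem Ku_mul_Ku (α β : K0 C) (x y : IsoClass C) :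
    Ku k α x * Ku k β y =
      Qv.v k ^ (eulerForm k C x.toK0 y.toK0 - symEulerForm k C β x.toK0) •
        ∑ᶠ l : IsoClass C, algebraMap ℚ (Qv k) (hallCoeff x y l) • Ku k (α + β) l := by
  have h : Ku k α x * Ku k β y =
      Qv.v k ^ (eulerForm k C x.toK0 y.toK0 - symEulerForm k C β x.toK0) •
        hallProduct k (α + β) x y := by
    rw [mul_def, mulMap, Ku, Ku, Module.Basis.constr_basis, Module.Basis.constr_basis]
  rw [h, hallProduct, finsum_eq_sum_of_support_subset]
  intro l hl
  rw [Set.Finite.coe_toFinset]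
  intro h0
  exact hl (by simp [h0])

end Het

end DerivedHall

/-! Write `a_X` for `autWeight X`, that is `|Aut X| {X, X}`. Everything rests on a symmetry: the
morphisms `X ⟶ Y` with cone `Z` and the morphisms `Y ⟶ Z` with cocone `X` have the same number up to
the weights `a_X`, `a_Z`, `{X, Y}`, `{Y, Z}` (`card_homWithCone_symm`). To see this, count pairs
`(f, g)` lying in a common triangle, weighted by a stabilizer, in two ways. For fixed `f` the
possible `g` form one `Aut Z`-orbit, and for fixed `g` the possible `f` form one `Aut X`-orbit. The
two stabilizers are compared through the maps `p : X[1] ⟶ Z` for which `1 + hp`, equivalently `1 +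
ph`, is invertible. The remaining discrepancy is computed from truncated long exact sequences
(`card_stabilizer_mul_shiftProd`).

The symmetry expresses a Hall number by cones or by cocones. Hence `F_{XY}^L F_{LZ}^M` counts
morphisms `u : L ⟶ M ⊞ Y` whose components have cone `Z` and cocone `X`, and `F_{YZ}^{L'} F_{XL'}^M`
counts morphisms `v : M ⊞ Y ⟶ L'` with matching conditions. By the octahedral axiom the conditions
on `u` and `v` agree whenever `L ⟶ M ⊞ Y ⟶ L'` is part of a triangle. Splitting the first count by
the cone of `u`, the second by the cocone of `v`, and applying the symmetry to each piece gives
associativity of the Hall numbers (`hallCoeff_assoc`).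

A nonzero `F_{XY}^L` forces `[L] = [X] + [Y]`, so the powers of `v` are constant along each sum;
they agree on both sides by biadditivity of the Euler form. The unit laws hold because a triangle
with a zero outer term is an isomorphism. -/

namespace DerivedHall

universe w u

/-! ### Alternating products along a truncated long exact sequence -/

/-- The alternating product `∏ r n ^ ((-1) ^ (n + 1))` over all natural numbers `n`. -/
noncomputable def altProd (r : ℕ → ℚ) : ℚ := ∏ᶠ n : ℕ, r n ^ ((-1 : ℤ) ^ (n + 1))

theorem altProd_eq_prod_range {r : ℕ → ℚ} {n : ℕ} (h : ∀ i, n ≤ i → r i = 1) :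
    altProd r = ∏ i ∈ Finset.range n, r i ^ ((-1 : ℤ) ^ (i + 1)) := by
  refine finprod_eq_prod_of_mulSupport_subset _ fun i hi => ?_
  by_contra hn
  exact hi (by simp [h i (by simpa using hn)])

theorem altProd_ne_zero {r : ℕ → ℚ} (h : ∀ i, r i ≠ 0) : altProd r ≠ 0 :=
  finprod_induction (· ≠ 0) one_ne_zero (fun _ _ => mul_ne_zero) fun i => zpow_ne_zero _ (h i)

/-- The factors `c i * c (i + 1)` enter with alternating exponents, so all the inner ones cancel and
only the two ends survive. -/
theorem prod_range_telescope {a b d c : ℕ → ℚ} (hc : ∀ i, c i ≠ 0) (h : ∀ i, a i * d i = b i * (c i * c (i + 1)))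
    (n : ℕ) :
    (∏ i ∈ Finset.range n, a i ^ ((-1 : ℤ) ^ (i + 1))) *
      (∏ i ∈ Finset.range n, d i ^ ((-1 : ℤ) ^ (i + 1))) * c 0 =
    (∏ i ∈ Finset.range n, b i ^ ((-1 : ℤ) ^ (i + 1))) * c n ^ ((-1 : ℤ) ^ n) := by
  induction n with
  | zero => simp
  | succ n ih =>
    simp only [Finset.prod_range_succ]
    set p := ∏ i ∈ Finset.range n, a i ^ ((-1 : ℤ) ^ (i + 1))
    set q := ∏ i ∈ Finset.range n, d i ^ ((-1 : ℤ) ^ (i + 1))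
    set r := ∏ i ∈ Finset.range n, b i ^ ((-1 : ℤ) ^ (i + 1))
    calc _ = (p * q * c 0) * (a n * d n) ^ ((-1 : ℤ) ^ (n + 1)) := by rw [mul_zpow]; ring
      _ = r * b n ^ ((-1 : ℤ) ^ (n + 1)) * c (n + 1) ^ ((-1 : ℤ) ^ (n + 1)) *
          (c n ^ ((-1 : ℤ) ^ n) * c n ^ ((-1 : ℤ) ^ (n + 1))) := by
        rw [ih, h, mul_zpow, mul_zpow]; ring
      _ = _ := by rw [← zpow_add₀ (hc n), pow_succ]; simp

theorem card_range_mul_card_ker {A B : Type*} [AddGroup A] [AddGroup B] (f : A →+ B) :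
    Nat.card f.range * Nat.card f.ker = Nat.card A := by
  rw [← AddSubgroup.index_ker, mul_comm, AddSubgroup.card_mul_index]

/-- The alternating product of cardinalities along an exact sequence
`⋯ ⟶ A 1 ⟶ B 1 ⟶ D 1 ⟶ A 0 ⟶ B 0 ⟶ D 0` of finite groups, almost all of them trivial. -/
theorem altProd_exact {A B D : ℕ → Type*} [∀ i, AddCommGroup (A i)] [∀ i, AddCommGroup (B i)]
    [∀ i, AddCommGroup (D i)] [∀ i, Finite (A i)] [∀ i, Finite (B i)] [∀ i, Finite (D i)]
    (hA : ∀ᶠ i in Filter.atTop, Nat.card (A i) = 1) (hB : ∀ᶠ i in Filter.atTop, Nat.card (B i) = 1)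
    (hD : ∀ᶠ i in Filter.atTop, Nat.card (D i) = 1)
    (f : ∀ i, A i →+ B i) (g : ∀ i, B i →+ D i) (d : ∀ i, D (i + 1) →+ A i)
    (hfg : ∀ i, (f i).range = (g i).ker) (hdf : ∀ i, (d i).range = (f i).ker)
    (hgd : ∀ i, (g (i + 1)).range = (d i).ker) :
    altProd (fun i => Nat.card (A i)) * altProd (fun i => Nat.card (D i)) * Nat.card (D 0) =
      altProd (fun i => Nat.card (B i)) * Nat.card (g 0).range := by
  obtain ⟨n, hn⟩ := Filter.eventually_atTop.mp (hA.and (hB.and hD))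
  -- For `i > 0` this is the order of the image of `D i` in `A (i - 1)`. Nothing leaves `D 0`, so `c
  -- 0` is the order of the cokernel of `g 0`: the defect caused by truncation.
  let c : ℕ → ℚ := fun i => (Nat.card (D i) : ℚ) / Nat.card (g i).range
  have pD (i) : (Nat.card (D i) : ℚ) ≠ 0 :=
    mod_cast Nat.card_ne_zero.mpr ⟨inferInstance, inferInstance⟩
  have pg (i) : (Nat.card (g i).range : ℚ) ≠ 0 :=
    mod_cast Nat.card_ne_zero.mpr ⟨inferInstance, inferInstance⟩
  have hc (i) : c (i + 1) = Nat.card (d i).range := by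
    have := card_range_mul_card_ker (d i)
    rw [← hgd] at this
    simp only [c]
    rw [div_eq_iff (pg _)]
    exact_mod_cast this.symm
  have key (i) : (Nat.card (A i) : ℚ) * Nat.card (D i) = Nat.card (B i) * (c i * c (i + 1)) := by
    have h1 := card_range_mul_card_ker (f i)
    have h2 := card_range_mul_card_ker (g i)
    rw [← hdf] at h1
    rw [← hfg] at h2
    rw [hc, ← h1, ← h2]
    simp only [c]
    push_cast
    have := pg i
    field_simp
  have cn : c n = 1 := by
    have h0 : Nat.card (g n).range ≤ 1 := by
      rw [← (hn n le_rfl).2.2]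
      exact Nat.card_le_card_of_injective _ Subtype.val_injective
    have h1 : Nat.card (g n).range = 1 := le_antisymm h0 (Nat.card_pos)
    simp only [c]
    rw [h1, (hn n le_rfl).2.2, Nat.cast_one, div_one]
  have t := prod_range_telescope
    (c := c) (fun i => div_ne_zero (pD i) (pg i)) key n
  rw [altProd_eq_prod_range (n := n) fun i hi => Nat.cast_eq_one.mpr (hn i hi).1,
    altProd_eq_prod_range (n := n) fun i hi => Nat.cast_eq_one.mpr (hn i hi).2.1,
    altProd_eq_prod_range (n := n) fun i hi => Nat.cast_eq_one.mpr (hn i hi).2.2]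
  rw [cn, one_zpow, mul_one] at t
  rw [← t, mul_assoc _ (c 0)]
  simp only [c]
  rw [div_mul_cancel₀ _ (pg 0)]

/-! ### Long exact sequences of a distinguished triangle -/

section

variable {C : Type u} [Category.{w} C] [Preadditive C] [HasShift C ℤ] [HasZeroObject C]
  [∀ n : ℤ, (shiftFunctor C n).Additive] [Pretriangulated C]
  {X Y Z : C} {f : X ⟶ Y} {g : Y ⟶ Z} {h : Z ⟶ X⟦(1 : ℤ)⟧}

theorem exists_comp_mor₁ (hT : Triangle.mk f g h ∈ distTriang C) {W : C} (p : W ⟶ Y)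
    (hp : p ≫ g = 0) : ∃ q, q ≫ f = p :=
  (Triangle.coyoneda_exact₂ _ hT p hp).imp fun _ => Eq.symm

theorem exists_comp_mor₂ (hT : Triangle.mk f g h ∈ distTriang C) {W : C} (p : W ⟶ Z)
    (hp : p ≫ h = 0) : ∃ q, q ≫ g = p :=
  (Triangle.coyoneda_exact₃ _ hT p hp).imp fun _ => Eq.symm

theorem exists_comp_mor₃ (hT : Triangle.mk f g h ∈ distTriang C) {W : C} (p : W ⟶ X)
    (hp : p ≫ f = 0) : ∃ q, q ≫ h = p⟦(1 : ℤ)⟧' :=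
  (Triangle.coyoneda_exact₁ _ hT (p⟦(1 : ℤ)⟧') (by
    change p⟦(1 : ℤ)⟧' ≫ f⟦(1 : ℤ)⟧' = 0
    rw [← Functor.map_comp, hp, Functor.map_zero])).imp fun _ => Eq.symm

theorem exists_mor₂_comp (hT : Triangle.mk f g h ∈ distTriang C) {V : C} (p : Y ⟶ V)
    (hp : f ≫ p = 0) : ∃ q, g ≫ q = p :=
  (Triangle.yoneda_exact₂ _ hT p hp).imp fun _ => Eq.symm

theorem exists_mor₃_comp (hT : Triangle.mk f g h ∈ distTriang C) {V : C} (p : Z ⟶ V)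
    (hp : g ≫ p = 0) : ∃ q, h ≫ q = p :=
  (Triangle.yoneda_exact₃ _ hT p hp).imp fun _ => Eq.symm

theorem exists_mor₁_comp (hT : Triangle.mk f g h ∈ distTriang C) {V : C} (p : X ⟶ V)
    (hp : h ≫ p⟦(1 : ℤ)⟧' = 0) : ∃ q, f ≫ q = p := by
  obtain ⟨y, hy⟩ := Triangle.yoneda_exact₃ _ (rot_of_distTriang _ hT) (p⟦(1 : ℤ)⟧') hp
  let F := shiftFunctor C (1 : ℤ)
  let y' : Y⟦(1 : ℤ)⟧ ⟶ V⟦(1 : ℤ)⟧ := y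
  -- The rotated triangle ends in `-f⟦1⟧'`, whence the sign.
  let q : Y ⟶ V := -F.preimage y'
  have hq : F.map q = -y' := by rw [Functor.map_neg, F.map_preimage]
  refine ⟨q, F.map_injective ?_⟩
  rw [Functor.map_comp, hq]
  refine Eq.trans ?_ hy.symm
  change F.map f ≫ (-y') = (-F.map f) ≫ y'
  rw [Preadditive.comp_neg, Preadditive.neg_comp]

end

/-! ### The products `{X, Y}` along a distinguished triangle -/

variable {C : Type u} [Category.{w} C] [HasShift C ℤ]

theorem shiftProd_eq_altProd (X Y : C) :
    shiftProd X Y = altProd fun n => Nat.card (X⟦(n : ℤ) + 1⟧ ⟶ Y) := rfl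

/-- Shifting is adjoint to shifting in the opposite direction. -/
noncomputable def shiftHomEquiv (X Y : C) (n : ℕ) :
    (X⟦(n : ℤ) + 1⟧ ⟶ Y) ≃ (X ⟶ Y⟦-((n : ℤ) + 1)⟧) :=
  (shiftEquiv' C ((n : ℤ) + 1) (-((n : ℤ) + 1)) (by simp)).toAdjunction.homEquiv X Y

/-- With the shift on the second argument, a triangle in the first argument acts by plain
precomposition. -/
theorem shiftProd_eq_altProd_right (X Y : C) :
    shiftProd X Y = altProd fun n => Nat.card (X ⟶ Y⟦-((n : ℤ) + 1)⟧) := by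
  rw [shiftProd_eq_altProd]
  exact congrArg altProd (funext fun n => by rw [Nat.card_congr (shiftHomEquiv X Y n)])

variable [Preadditive C]

theorem shiftProd_ne_zero [∀ X Y : C, Finite (X ⟶ Y)] (X Y : C) : shiftProd X Y ≠ 0 :=
  altProd_ne_zero fun _ => mod_cast Nat.card_ne_zero.mpr ⟨inferInstance, inferInstance⟩

theorem eventually_card_shift (hfin : ∀ X Y : C, {i : ℤ | Nontrivial (X⟦i⟧ ⟶ Y)}.Finite) (X Y : C) :
    ∀ᶠ n : ℕ in Filter.atTop, Nat.card (X⟦(n : ℤ) + 1⟧ ⟶ Y) = 1 := by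
  have h : {n : ℕ | Nontrivial (X⟦(n : ℤ) + 1⟧ ⟶ Y)}.Finite :=
    (hfin X Y).preimage (f := fun n : ℕ => (n : ℤ) + 1) (fun a _ b _ h => by simpa using h)
  filter_upwards [Nat.cofinite_eq_atTop ▸ h.compl_mem_cofinite] with n hn
  have : Subsingleton (X⟦(n : ℤ) + 1⟧ ⟶ Y) := not_nontrivial_iff_subsingleton.mp hn
  exact Nat.card_unique

variable [∀ X Y : C, Finite (X ⟶ Y)]
variable [HasZeroObject C] [∀ n : ℤ, (shiftFunctor C n).Additive] [Pretriangulated C]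

/-- This is the long exact sequence of `Hom(W, -)` cut off at `Hom(W[1], Z)`. The image of
`Hom(W[1], Y)` there is the kernel of composition with `h`, which gives the correction factor on the
right. -/
theorem shiftProd_mul_left (hfin : ∀ X Y : C, {i : ℤ | Nontrivial (X⟦i⟧ ⟶ Y)}.Finite)
    {X Y Z : C} {f : X ⟶ Y} {g : Y ⟶ Z} {h : Z ⟶ X⟦(1 : ℤ)⟧}
    (hT : Triangle.mk f g h ∈ distTriang C) (W : C) :
    shiftProd W X * shiftProd W Z * Nat.card (W⟦(1 : ℤ)⟧ ⟶ Z) =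
      shiftProd W Y * Nat.card {p : W⟦(1 : ℤ)⟧ ⟶ Z // p ≫ h = 0} := by
  let e (n : ℕ) : (W⟦(n : ℤ) + 1⟧)⟦(1 : ℤ)⟧ ≅ W⟦((n + 1 : ℕ) : ℤ) + 1⟧ :=
    ((shiftFunctorAdd' C ((n : ℤ) + 1) 1 (((n + 1 : ℕ) : ℤ) + 1) (by push_cast; ring)).app W).symm
  let F := shiftFunctor C (1 : ℤ)
  -- The connecting map: composition with `h` lands in `X⟦1⟧`, and one shift is removed by full
  -- faithfulness.
  let d (n : ℕ) : (W⟦((n + 1 : ℕ) : ℤ) + 1⟧ ⟶ Z) →+ (W⟦(n : ℤ) + 1⟧ ⟶ X) :=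
    AddMonoidHom.mk' (fun x => F.preimage ((e n).hom ≫ x ≫ h)) fun x y =>
      F.map_injective (by simp)
  have hd (n : ℕ) (x) : (d n x)⟦(1 : ℤ)⟧' = (e n).hom ≫ x ≫ h := F.map_preimage _
  have z12 : f ≫ g = 0 := comp_distTriang_mor_zero₁₂ _ hT
  have z23 : g ≫ h = 0 := comp_distTriang_mor_zero₂₃ _ hT
  have z31 : h ≫ f⟦(1 : ℤ)⟧' = 0 := comp_distTriang_mor_zero₃₁ _ hT
  have key := altProd_exact (eventually_card_shift hfin W X) (eventually_card_shift hfin W Y)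
    (eventually_card_shift hfin W Z) (fun i => Preadditive.rightComp _ f)
    (fun i => Preadditive.rightComp _ g) d ?_ ?_ ?_
  · rw [← shiftProd_eq_altProd, ← shiftProd_eq_altProd, ← shiftProd_eq_altProd] at key
    let e0 : W⟦((0 : ℕ) : ℤ) + 1⟧ ≅ W⟦(1 : ℤ)⟧ := eqToIso (by simp)
    rw [Nat.card_congr (e0.homCongr (Iso.refl Z))] at key
    rw [key]
    congr 2
    refine Nat.card_congr ((e0.homCongr (Iso.refl Z)).subtypeEquiv fun p => ?_)
    have : (e0.homCongr (Iso.refl Z)) p ≫ h = 0 ↔ p ≫ h = 0 := by simp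
    rw [this]
    constructor
    · rintro ⟨y, rfl⟩
      change (y ≫ g) ≫ h = 0
      rw [Category.assoc, z23, comp_zero]
    · intro hp
      exact exists_comp_mor₂ hT p hp
  · intro i
    ext x
    constructor
    · rintro ⟨y, rfl⟩
      change (y ≫ f) ≫ g = 0
      rw [Category.assoc, z12, comp_zero]
    · intro hx
      exact exists_comp_mor₁ hT x hx
  · intro i
    ext x
    constructor
    · rintro ⟨y, rfl⟩
      change d i y ≫ f = 0
      refine F.map_injective ?_
      change (d i y ≫ f)⟦(1 : ℤ)⟧' = _
      rw [Functor.map_comp, hd, Category.assoc, Category.assoc, z31, comp_zero, comp_zero,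
        Functor.map_zero]
    · intro hx
      obtain ⟨y, hy⟩ := exists_comp_mor₃ hT x hx
      refine ⟨(e i).inv ≫ y, F.map_injective ?_⟩
      change (d i _)⟦(1 : ℤ)⟧' = _
      rw [hd, Category.assoc, Iso.hom_inv_id_assoc]
      exact hy
  · intro i
    ext x
    have hx' : x ∈ (d i).ker ↔ x ≫ h = 0 := by
      rw [AddMonoidHom.mem_ker, ← (shiftFunctor C (1 : ℤ)).map_eq_zero_iff, hd,
        Preadditive.IsIso.comp_left_eq_zero]
    rw [hx']
    constructor
    · rintro ⟨y, rfl⟩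
      change (y ≫ g) ≫ h = 0
      rw [Category.assoc, z23, comp_zero]
    · intro hx
      exact exists_comp_mor₂ hT x hx

/-- The dual sequence, for `Hom(-, V)`, cut off at `Hom(X, V[-1])`. Shifting once identifies this
last term with `Hom(X[1], V)` and the image of `Hom(Y, V[-1])` with the maps killed by `h`. -/
theorem shiftProd_mul_right (hfin : ∀ X Y : C, {i : ℤ | Nontrivial (X⟦i⟧ ⟶ Y)}.Finite)
    {X Y Z : C} {f : X ⟶ Y} {g : Y ⟶ Z} {h : Z ⟶ X⟦(1 : ℤ)⟧}
    (hT : Triangle.mk f g h ∈ distTriang C) (V : C) :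
    shiftProd Z V * shiftProd X V * Nat.card (X⟦(1 : ℤ)⟧ ⟶ V) =
      shiftProd Y V * Nat.card {p : X⟦(1 : ℤ)⟧ ⟶ V // h ≫ p = 0} := by
  let e (n : ℕ) : (V⟦-(((n + 1 : ℕ) : ℤ) + 1)⟧)⟦(1 : ℤ)⟧ ≅ V⟦-((n : ℤ) + 1)⟧ :=
    ((shiftFunctorAdd' C (-(((n + 1 : ℕ) : ℤ) + 1)) 1 (-((n : ℤ) + 1))
      (by push_cast; ring)).app V).symm
  let F := shiftFunctor C (1 : ℤ)
  let d (n : ℕ) : (X ⟶ V⟦-(((n + 1 : ℕ) : ℤ) + 1)⟧) →+ (Z ⟶ V⟦-((n : ℤ) + 1)⟧) :=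
    AddMonoidHom.mk' (fun x => h ≫ x⟦(1 : ℤ)⟧' ≫ (e n).hom) fun x y => by simp
  have z12 : f ≫ g = 0 := comp_distTriang_mor_zero₁₂ _ hT
  have z23 : g ≫ h = 0 := comp_distTriang_mor_zero₂₃ _ hT
  have z31 : h ≫ f⟦(1 : ℤ)⟧' = 0 := comp_distTriang_mor_zero₃₁ _ hT
  have ev (A : C) : ∀ᶠ n : ℕ in Filter.atTop, Nat.card (A ⟶ V⟦-((n : ℤ) + 1)⟧) = 1 := by
    filter_upwards [eventually_card_shift hfin A V] with n hn
    rwa [← Nat.card_congr (shiftHomEquiv A V n)]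
  have key := altProd_exact (ev Z) (ev Y) (ev X) (fun i => Preadditive.leftComp _ g)
    (fun i => Preadditive.leftComp _ f) d ?_ ?_ ?_
  · rw [← shiftProd_eq_altProd_right, ← shiftProd_eq_altProd_right,
      ← shiftProd_eq_altProd_right] at key
    let e0 : (V⟦-(((0 : ℕ) : ℤ) + 1)⟧)⟦(1 : ℤ)⟧ ≅ V :=
      (shiftFunctorCompIsoId C (-(((0 : ℕ) : ℤ) + 1)) 1 (by simp)).app V
    let E : (X ⟶ V⟦-(((0 : ℕ) : ℤ) + 1)⟧) ≃ (X⟦(1 : ℤ)⟧ ⟶ V) :=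
      (Functor.FullyFaithful.ofFullyFaithful F).homEquiv.trans ((Iso.refl _).homCongr e0)
    have hE (x) : E x = F.map x ≫ e0.hom := Category.id_comp _
    rw [Nat.card_congr E] at key
    rw [key]
    congr 2
    refine Nat.card_congr (E.subtypeEquiv fun p => ?_)
    rw [hE, ← Category.assoc, Preadditive.IsIso.comp_right_eq_zero]
    constructor
    · rintro ⟨y, rfl⟩
      change h ≫ F.map (f ≫ y) = 0
      rw [Functor.map_comp, ← Category.assoc, z31, zero_comp]
    · exact exists_mor₁_comp hT p
  · intro i
    ext x
    constructor
    · rintro ⟨y, rfl⟩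
      change f ≫ g ≫ y = 0
      rw [← Category.assoc, z12, zero_comp]
    · intro hx
      exact exists_mor₂_comp hT x hx
  · intro i
    ext x
    constructor
    · rintro ⟨y, rfl⟩
      change g ≫ h ≫ _ = 0
      rw [← Category.assoc, z23, zero_comp]
    · intro hx
      obtain ⟨y, hy⟩ := exists_mor₃_comp hT x hx
      refine ⟨F.preimage (y ≫ (e i).inv), ?_⟩
      change h ≫ F.map _ ≫ (e i).hom = x
      rw [F.map_preimage]
      simpa using hy
  · intro i
    ext x
    have hx' : x ∈ (d i).ker ↔ h ≫ x⟦(1 : ℤ)⟧' = 0 := by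
      rw [AddMonoidHom.mem_ker]
      change h ≫ _ ≫ _ = 0 ↔ _
      rw [← Category.assoc, Preadditive.IsIso.comp_right_eq_zero]
    rw [hx']
    constructor
    · rintro ⟨y, rfl⟩
      change h ≫ F.map (f ≫ y) = 0
      rw [Functor.map_comp, ← Category.assoc, z31, zero_comp]
    · exact exists_mor₁_comp hT x

/-! ### Counting lemmas -/

/-- Each fibre over a point of `T` is a coset of the kernel; `s` chooses a base point in it. -/
theorem card_preimage_of_subset_range {A B : Type*} [AddGroup A] [AddGroup B] (θ : A →+ B)
    (T : Set B) (hT : ∀ t ∈ T, ∃ a, θ a = t) :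
    Nat.card (θ ⁻¹' T) = Nat.card T * Nat.card θ.ker := by
  choose s hs using hT
  rw [← Nat.card_prod]
  refine Nat.card_congr
    { toFun := fun a => (⟨θ a, a.2⟩, ⟨a - s (θ a) a.2, by simp [AddMonoidHom.mem_ker, hs]⟩)
      invFun := fun p => ⟨p.2 + s p.1 p.1.2, ?_⟩
      left_inv := fun a => Subtype.ext (by simp)
      right_inv := fun p => ?_ }
  · have h2 : θ p.2 = 0 := p.2.2
    simp [h2, hs]
  · have h2 : θ p.2 = 0 := p.2.2
    have h3 : θ (p.2 + s p.1 p.1.2) = p.1 := by simp [h2, hs]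
    refine Prod.ext (Subtype.ext h3) (Subtype.ext ?_)
    simp only [h3, add_sub_cancel_right]

/-- If each nonempty fibre `{b | P a b}` is an orbit of `G`, then counting pairs with weights
given by the stabilizers amounts to counting the elements `a` with a nonempty fibre. -/
theorem card_pairs_with_stabilizer {A B G : Type*} [Group G] [MulAction G B] (P : A → B → Prop)
    (hsmul : ∀ a b (c : G), P a b → P a (c • b))
    (htrans : ∀ a b b', P a b → P a b' → ∃ c : G, c • b = b') :
    Nat.card (Σ p : {p : A × B // P p.1 p.2}, {c : G // c • p.1.2 = p.1.2}) =
      Nat.card {a // ∃ b, P a b} * Nat.card G := by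
  rw [← Nat.card_prod]
  choose b₀ hb₀ using fun a : {a // ∃ b, P a b} => a.2
  -- `t a b` carries the base point `b₀ a` to `b`. Multiplying a stabilizer element of `b` by it
  -- gives every group element exactly once as `b` runs over the orbit.
  choose t ht using fun (a : {a // ∃ b, P a b}) (b : B) (h : P a b) => htrans a _ b (hb₀ a) h
  refine Nat.card_congr
    { toFun := fun x => (⟨x.1.1.1, x.1.1.2, x.1.2⟩, x.2.1 * t ⟨x.1.1.1, x.1.1.2, x.1.2⟩ _ x.1.2)
      invFun := fun y => ⟨⟨(y.1, y.2 • b₀ y.1), hsmul _ _ _ (hb₀ y.1)⟩,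
        ⟨y.2 * (t y.1 _ (hsmul _ _ y.2 (hb₀ y.1)))⁻¹, ?_⟩⟩
      left_inv := ?_
      right_inv := fun y => by simp }
  · rw [mul_smul, inv_smul_eq_iff.mpr (ht _ _ _).symm]
  · rintro ⟨⟨⟨a, b⟩, h⟩, ⟨c, hc⟩⟩
    have e : (c * t ⟨a, b, h⟩ b h) • b₀ ⟨a, b, h⟩ = b := by rw [mul_smul, ht, hc]
    have key : ∀ b' (h' : P a b') (c' : G) (hc' : c' • b' = b') (c'' : G), b' = b → c'' = c →
        c' = c'' → (⟨⟨(a, b'), h'⟩, ⟨c', hc'⟩⟩ :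
          Σ p : {p : A × B // P p.1 p.2}, {c : G // c • p.1.2 = p.1.2}) =
            ⟨⟨(a, b), h⟩, ⟨c, hc⟩⟩ := by
      rintro _ _ _ _ _ rfl rfl rfl
      rfl
    refine key _ _ _ _ c e rfl ?_
    have : ∀ b' (h' : P a b'), b' = b → t ⟨a, b, h⟩ b' h' = t ⟨a, b, h⟩ b h := by
      rintro _ _ rfl
      rfl
    dsimp only
    rw [this _ _ e, mul_inv_cancel_right]

section

variable {C : Type u} [Category.{w} C]

/-- Automorphisms of the target act on morphisms. -/
abbrev autActionTarget (X Y : C) : MulAction (Aut Y) (X ⟶ Y) where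
  smul a f := f ≫ a.hom
  one_smul f := Category.comp_id f
  mul_smul a b f := (Category.assoc f b.hom a.hom).symm

/-- Automorphisms of the source act on morphisms. -/
abbrev autActionSource (X Y : C) : MulAction (Aut X) (X ⟶ Y) where
  -- The product in `Aut X` is composition in reverse order, so the inverse is needed for a left
  -- action.
  smul a f := a.inv ≫ f
  one_smul f := Category.id_comp f
  mul_smul a b f := Category.assoc a.inv b.inv f

theorem finite_aut (X : C) [Finite (X ⟶ X)] : Finite (Aut X) :=
  Finite.of_injective (fun a : X ≅ X => a.hom) fun _ _ h => Iso.ext h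

variable [Preadditive C]

/-- If `c` is the inverse of `1 + ab`, then `1 - bca` is the inverse of `1 + ba`, as in a ring. -/
theorem isIso_id_add_comp {X Y : C} (a : X ⟶ Y) (b : Y ⟶ X) (h : IsIso (𝟙 X + a ≫ b)) :
    IsIso (𝟙 Y + b ≫ a) := by
  let c := inv (𝟙 X + a ≫ b)
  have h1 : c + a ≫ b ≫ c = 𝟙 X := by
    have := IsIso.hom_inv_id (𝟙 X + a ≫ b)
    rwa [Preadditive.add_comp, Category.id_comp, Category.assoc] at this
  have h2 : c + c ≫ a ≫ b = 𝟙 X := by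
    have := IsIso.inv_hom_id (𝟙 X + a ≫ b)
    rwa [Preadditive.comp_add, Category.comp_id] at this
  refine ⟨𝟙 Y - b ≫ c ≫ a, ?_, ?_⟩
  · have h3 : b ≫ a ≫ b ≫ c ≫ a = b ≫ a - b ≫ c ≫ a := by
      rw [eq_sub_iff_add_eq']
      have := congrArg (fun z => b ≫ z ≫ a) h1
      simpa using this
    simp [h3]
  · have h3 : b ≫ c ≫ a ≫ b ≫ a = b ≫ a - b ≫ c ≫ a := by
      rw [eq_sub_iff_add_eq']
      have := congrArg (fun z => b ≫ z ≫ a) h2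
      simpa using this
    simp [h3]

end

/-! ### Stabilizers in a distinguished triangle and the cone–cocone symmetry -/

section

variable {C : Type u} [Category.{w} C] [Preadditive C] [HasShift C ℤ] [HasZeroObject C]
  [∀ n : ℤ, (shiftFunctor C n).Additive] [Pretriangulated C]

/-- The morphisms `L ⟶ Y` that fit into a distinguished triangle `X ⟶ L ⟶ Y ⟶ X[1]`. -/
def homWithCocone (X L Y : C) : Set (L ⟶ Y) :=
  {g | ∃ (f : X ⟶ L) (h : Y ⟶ X⟦(1 : ℤ)⟧), Triangle.mk f g h ∈ distTriang C}

variable {X Y Z : C} {f : X ⟶ Y} {g : Y ⟶ Z} {h : Z ⟶ X⟦(1 : ℤ)⟧}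

/-- An automorphism `a` fixes `g` exactly when `a - 1` kills `g`, that is, `a = 1 + hp` for some
`p`. The choices of `p` for a given `a` form a coset of `{p | hp = 0}`. -/
theorem card_stabilizer_target (hT : Triangle.mk f g h ∈ distTriang C) :
    Nat.card {a : Aut Z // g ≫ a.hom = g} * Nat.card {p : X⟦(1 : ℤ)⟧ ⟶ Z // h ≫ p = 0} =
      Nat.card {p : X⟦(1 : ℤ)⟧ ⟶ Z // IsIso (𝟙 Z + h ≫ p)} := by
  have z23 : g ≫ h = 0 := comp_distTriang_mor_zero₂₃ _ hT
  let T : Set (Z ⟶ Z) := {t | IsIso (𝟙 Z + t) ∧ ∃ p, h ≫ p = t}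
  have h1 := card_preimage_of_subset_range (Preadditive.leftComp Z h) T fun t ht => ht.2
  have e : {a : Aut Z // g ≫ a.hom = g} ≃ T :=
    { toFun := fun a => ⟨a.1.hom - 𝟙 Z, by
        rw [add_sub_cancel]; exact Iso.isIso_hom a.1, exists_mor₃_comp hT _ (by simp [a.2])⟩
      invFun := fun t => ⟨@asIso C _ Z Z (𝟙 Z + t.1) t.2.1, by
        obtain ⟨t, ht, p, rfl⟩ := t
        simp [reassoc_of% z23]⟩
      left_inv := fun a => by ext; simp
      right_inv := fun t => by ext; simp }
  rw [Nat.card_congr e]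
  refine h1.symm.trans (Nat.card_congr (Equiv.subtypeEquivRight fun p => ?_))
  exact and_iff_left ⟨p, rfl⟩

/-- Here `a.inv - 1`, once shifted, factors through `h`, so that `a.inv⟦1⟧' = 1 + ph`; full
faithfulness of the shift recovers `a` from this. -/
theorem card_stabilizer_source (hT : Triangle.mk f g h ∈ distTriang C) :
    Nat.card {a : Aut X // a.inv ≫ f = f} * Nat.card {p : X⟦(1 : ℤ)⟧ ⟶ Z // p ≫ h = 0} =
      Nat.card {p : X⟦(1 : ℤ)⟧ ⟶ Z // IsIso (𝟙 _ + p ≫ h)} := by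
  have z31 : h ≫ f⟦(1 : ℤ)⟧' = 0 := comp_distTriang_mor_zero₃₁ _ hT
  let F := shiftFunctor C (1 : ℤ)
  let T : Set (X⟦(1 : ℤ)⟧ ⟶ X⟦(1 : ℤ)⟧) := {t | IsIso (𝟙 _ + t) ∧ ∃ p, p ≫ h = t}
  have h1 := card_preimage_of_subset_range (Preadditive.rightComp (X⟦(1 : ℤ)⟧) h) T fun t ht => ht.2
  have hF (t : X⟦(1 : ℤ)⟧ ⟶ X⟦(1 : ℤ)⟧) : F.map (𝟙 X + F.preimage t) = 𝟙 _ + t := by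
    rw [F.map_add, F.map_preimage, F.map_id]
  have e : {a : Aut X // a.inv ≫ f = f} ≃ T :=
    { toFun := fun a => ⟨F.map (a.1.inv - 𝟙 X), by
        rw [F.map_sub, F.map_id, add_sub_cancel]; exact (F.mapIso a.1).isIso_inv,
          exists_comp_mor₃ hT _ (by simp [a.2])⟩
      invFun := fun t =>
        have : IsIso (F.map (𝟙 X + F.preimage t.1)) := by rw [hF]; exact t.2.1
        have : IsIso (𝟙 X + F.preimage t.1) := isIso_of_fully_faithful F _
        ⟨(asIso (𝟙 X + F.preimage t.1)).symm, by
          obtain ⟨t, ht, p, rfl⟩ := t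
          refine F.map_injective ?_
          change F.map ((𝟙 X + F.preimage (p ≫ h)) ≫ f) = _
          rw [F.map_comp, hF, Preadditive.add_comp, Category.id_comp, Category.assoc, z31,
            comp_zero, add_zero]⟩
      left_inv := fun a => by
        refine Subtype.ext (Iso.ext_inv ?_)
        change 𝟙 X + F.preimage (F.map (a.1.inv - 𝟙 X)) = a.1.inv
        rw [F.preimage_map, add_sub_cancel]
      right_inv := fun t => by ext; simp }
  rw [Nat.card_congr e]
  refine h1.symm.trans (Nat.card_congr (Equiv.subtypeEquivRight fun p => ?_))
  exact and_iff_left ⟨p, rfl⟩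

/-- Cones are unique up to isomorphism, so `Aut Z` acts transitively on the maps `g` that complete a
given `f`. -/
theorem exists_aut_target {X Y Z : C} {f : X ⟶ Y} {g g' : Y ⟶ Z} {h h' : Z ⟶ X⟦(1 : ℤ)⟧}
    (hT : Triangle.mk f g h ∈ distTriang C) (hT' : Triangle.mk f g' h' ∈ distTriang C) :
    ∃ a : Aut Z, g ≫ a.hom = g' := by
  let e := isoTriangleOfIso₁₂ _ _ hT hT' (Iso.refl X) (Iso.refl Y)
    ((Category.comp_id f).trans (Category.id_comp f).symm)
  exact ⟨Triangle.π₃.mapIso e, e.hom.comm₂.trans (Category.id_comp g')⟩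

theorem exists_aut_source {X Y Z : C} {f f' : X ⟶ Y} {g : Y ⟶ Z} {h h' : Z ⟶ X⟦(1 : ℤ)⟧}
    (hT : Triangle.mk f g h ∈ distTriang C) (hT' : Triangle.mk f' g h' ∈ distTriang C) :
    ∃ a : Aut X, a.inv ≫ f = f' := by
  obtain ⟨a, ha, ha'⟩ := complete_distinguished_triangle_morphism₁ _ _ hT' hT (𝟙 Y) (𝟙 Z)
    ((Category.comp_id g).trans (Category.id_comp g).symm)
  let φ : Triangle.mk f' g h' ⟶ Triangle.mk f g h :=
    { hom₁ := a, hom₂ := 𝟙 Y, hom₃ := 𝟙 Z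
      comm₁ := ha
      comm₂ := (Category.comp_id g).trans (Category.id_comp g).symm
      comm₃ := ha' }
  have : IsIso a := isIso₁_of_isIso₂₃ φ hT' hT (inferInstanceAs (IsIso (𝟙 Y)))
    (inferInstanceAs (IsIso (𝟙 Z)))
  exact ⟨(@asIso C _ X X a this).symm, ha.symm.trans (Category.comp_id f')⟩

theorem triangle_comp_aut_target {X Y Z : C} {f : X ⟶ Y} {g : Y ⟶ Z} {h : Z ⟶ X⟦(1 : ℤ)⟧}
    (hT : Triangle.mk f g h ∈ distTriang C) (a : Z ≅ Z) :
    Triangle.mk f (g ≫ a.hom) (a.inv ≫ h) ∈ distTriang C := by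
  refine isomorphic_distinguished _ hT _
    (Triangle.isoMk _ _ (Iso.refl X) (Iso.refl Y) a.symm ?_ ?_ ?_)
  · exact (Category.comp_id f).trans (Category.id_comp f).symm
  · change (g ≫ a.hom) ≫ a.inv = 𝟙 Y ≫ g
    simp
  · change (a.inv ≫ h) ≫ (𝟙 X)⟦(1 : ℤ)⟧' = a.inv ≫ h
    simp

theorem triangle_comp_aut_source {X Y Z : C} {f : X ⟶ Y} {g : Y ⟶ Z} {h : Z ⟶ X⟦(1 : ℤ)⟧}
    (hT : Triangle.mk f g h ∈ distTriang C) (a : X ≅ X) :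
    Triangle.mk (a.inv ≫ f) g (h ≫ a.hom⟦(1 : ℤ)⟧') ∈ distTriang C := by
  refine isomorphic_distinguished _ hT _
    (Triangle.isoMk _ _ a.symm (Iso.refl Y) (Iso.refl Z) ?_ ?_ ?_)
  · exact Category.comp_id _
  · exact (Category.comp_id g).trans (Category.id_comp g).symm
  · change (h ≫ a.hom⟦(1 : ℤ)⟧') ≫ a.inv⟦(1 : ℤ)⟧' = 𝟙 Z ≫ h
    simp [← Functor.map_comp]

variable [∀ X Y : C, Finite (X ⟶ Y)]

/-- Both stabilizer counts refer to the same set of `p`, by `isIso_id_add_comp`. The kernels `{ph =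
0}` and `{hp = 0}` are evaluated by the long exact sequences for `Hom(X, -)` and `Hom(-, Z)`, and
the common factor `{X, Z} |Hom(X[1], Z)|` cancels. -/
theorem card_stabilizer_mul_shiftProd
    (hfin : ∀ X Y : C, {i : ℤ | Nontrivial (X⟦i⟧ ⟶ Y)}.Finite)
    (hT : Triangle.mk f g h ∈ distTriang C) :
    (Nat.card {a : Aut Z // g ≫ a.hom = g} : ℚ) * (shiftProd Z Z * shiftProd X Y) =
      Nat.card {a : Aut X // a.inv ≫ f = f} * (shiftProd X X * shiftProd Y Z) := by
  have h1 := card_stabilizer_target hT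
  have h2 := card_stabilizer_source hT
  have h3 : Nat.card {p : X⟦(1 : ℤ)⟧ ⟶ Z // IsIso (𝟙 Z + h ≫ p)} =
      Nat.card {p : X⟦(1 : ℤ)⟧ ⟶ Z // IsIso (𝟙 _ + p ≫ h)} :=
    Nat.card_congr (Equiv.subtypeEquivRight fun p =>
      ⟨isIso_id_add_comp h p, isIso_id_add_comp p h⟩)
  rw [h3, ← h2] at h1
  have h4 := shiftProd_mul_left hfin hT X
  have h5 := shiftProd_mul_right hfin hT Z
  have h6 : (Nat.card (X⟦(1 : ℤ)⟧ ⟶ Z) : ℚ) ≠ 0 :=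
    mod_cast Nat.card_ne_zero.mpr ⟨inferInstance, inferInstance⟩
  have h7 := shiftProd_ne_zero X Z
  have h1' : (Nat.card {a : Aut Z // g ≫ a.hom = g} : ℚ) *
      Nat.card {p : X⟦(1 : ℤ)⟧ ⟶ Z // h ≫ p = 0} =
      Nat.card {a : Aut X // a.inv ≫ f = f} * Nat.card {p : X⟦(1 : ℤ)⟧ ⟶ Z // p ≫ h = 0} :=
    mod_cast h1
  refine mul_right_cancel₀ (mul_ne_zero h7 h6) ?_
  linear_combination (Nat.card {a : Aut Z // g ≫ a.hom = g} : ℚ) * shiftProd X Y * h5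
    - (Nat.card {a : Aut X // a.inv ≫ f = f} : ℚ) * shiftProd Y Z * h4
    + shiftProd X Y * shiftProd Y Z * h1'


/-- Morphisms `X ⟶ Y` with cone `Z` and morphisms `Y ⟶ Z` with cocone `X` are counted by the same
number, up to the factors `|Aut X| {X, X}` and `|Aut Z| {Z, Z}`. The same holds for subsets `S`
and `S'` of such morphisms that correspond to each other. -/
theorem card_homWithCone_symm (hfin : ∀ X Y : C, {i : ℤ | Nontrivial (X⟦i⟧ ⟶ Y)}.Finite)
    {X Y Z : C} (S : Set (X ⟶ Y)) (S' : Set (Y ⟶ Z))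
    (hS : ∀ f g h, Triangle.mk f g h ∈ distTriang C → (f ∈ S ↔ g ∈ S')) :
    (Nat.card ↥(S ∩ homWithCone X Y Z) : ℚ) * Nat.card (Aut Z) *
        (shiftProd Z Z * shiftProd X Y) =
      Nat.card ↥(S' ∩ homWithCocone X Y Z) * Nat.card (Aut X) *
        (shiftProd X X * shiftProd Y Z) := by
  -- By `hS`, demanding `f ∈ S` also puts `g` in `S'`; one relation thus serves both ways of
  -- counting.
  let P (f : X ⟶ Y) (g : Y ⟶ Z) : Prop := f ∈ S ∧ ∃ h, Triangle.mk f g h ∈ distTriang C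
  let _ := autActionTarget Y Z
  let _ := autActionSource X Y
  have h1 := card_pairs_with_stabilizer (G := Aut Z) P
    (fun f g a ⟨hf, h, hT⟩ => ⟨hf, _, triangle_comp_aut_target hT a⟩)
    (fun f g g' ⟨_, _, hT⟩ ⟨_, _, hT'⟩ => exists_aut_target hT hT')
  have h2 := card_pairs_with_stabilizer (G := Aut X) (fun g f => P f g)
    (fun g f a ⟨hf, h, hT⟩ => ⟨(hS _ _ _ (triangle_comp_aut_source hT a)).mpr
      ((hS _ _ _ hT).mp hf), _, triangle_comp_aut_source hT a⟩)
    (fun g f f' ⟨_, _, hT⟩ ⟨_, _, hT'⟩ => exists_aut_source hT hT')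
  have e1 : Nat.card {f // ∃ g, P f g} = Nat.card ↥(S ∩ homWithCone X Y Z) :=
    Nat.card_congr (Equiv.subtypeEquivRight fun f => exists_and_left)
  have e2 : Nat.card {g // ∃ f, P f g} = Nat.card ↥(S' ∩ homWithCocone X Y Z) :=
    Nat.card_congr (Equiv.subtypeEquivRight fun g =>
      ⟨fun ⟨f, hf, h, hT⟩ => ⟨(hS f g h hT).mp hf, f, h, hT⟩,
        fun ⟨hg, f, h, hT⟩ => ⟨f, (hS f g h hT).mpr hg, h, hT⟩⟩)
  rw [← e1, ← e2]
  have := finite_aut X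
  have := finite_aut Z
  have := Fintype.ofFinite {p : (X ⟶ Y) × (Y ⟶ Z) // P p.1 p.2}
  have := Fintype.ofFinite {p : (Y ⟶ Z) × (X ⟶ Y) // P p.2 p.1}
  rw [Nat.card_sigma] at h1 h2
  rw [← Nat.cast_mul, ← Nat.cast_mul, ← h1, ← h2, Nat.cast_sum, Nat.cast_sum]
  rw [Finset.sum_mul, Finset.sum_mul]
  let e : {p : (X ⟶ Y) × (Y ⟶ Z) // P p.1 p.2} ≃ {p : (Y ⟶ Z) × (X ⟶ Y) // P p.2 p.1} :=
    (Equiv.prodComm _ _).subtypeEquiv fun p => Iff.rfl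
  refine Fintype.sum_equiv e _ _ ?_
  rintro ⟨⟨f, g⟩, _, h, hT⟩
  exact card_stabilizer_mul_shiftProd hfin hT

end

theorem altProd_mul {r s : ℕ → ℚ} (hr : ∀ᶠ i in Filter.atTop, r i = 1)
    (hs : ∀ᶠ i in Filter.atTop, s i = 1) :
    altProd (fun i => r i * s i) = altProd r * altProd s := by
  obtain ⟨n, hn⟩ := Filter.eventually_atTop.mp (hr.and hs)
  rw [altProd_eq_prod_range (n := n) fun i hi => (hn i hi).1,
    altProd_eq_prod_range (n := n) fun i hi => (hn i hi).2,
    altProd_eq_prod_range (n := n) fun i hi => by rw [(hn i hi).1, (hn i hi).2, one_mul],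
    ← Finset.prod_mul_distrib]
  exact Finset.prod_congr rfl fun i _ => mul_zpow _ _ _

theorem sum_card_inter {A ι : Type*} [Finite A] (S : Set A) (E : ι → Set A) (t : Finset ι)
    (h : ∀ a ∈ S, ∃! i, a ∈ E i) (ht : ∀ i, (S ∩ E i).Nonempty → i ∈ t) :
    ∑ i ∈ t, Nat.card ↥(S ∩ E i) = Nat.card S := by
  rw [← Finset.sum_coe_sort, ← Nat.card_sigma]
  refine Nat.card_congr (Equiv.ofBijective (fun x => (⟨x.2.1, x.2.2.1⟩ : S)) ⟨?_, ?_⟩)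
  · rintro ⟨i, a, ha, hi⟩ ⟨j, b, hb, hj⟩ hab
    obtain rfl : a = b := congrArg Subtype.val hab
    obtain rfl : i = j := Subtype.ext ((h a ha).unique hi hj)
    rfl
  · rintro ⟨a, ha⟩
    obtain ⟨i, hi, -⟩ := h a ha
    exact ⟨⟨⟨i, ht i ⟨a, ha, hi⟩⟩, a, ha, hi⟩, rfl⟩

section

variable {C : Type u} [Category.{w} C]

theorem isoClass_out (l : IsoClass C) : isoClass l.out = l := Quotient.out_eq l

variable [HasShift C ℤ]

/-- The number `|Aut X| {X, X}`. -/
noncomputable def autWeight (X : C) : ℚ := Nat.card (Aut X) * shiftProd X X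

theorem autWeight_ne_zero [Preadditive C] [∀ X Y : C, Finite (X ⟶ Y)] (X : C) :
    autWeight X ≠ 0 := by
  have := finite_aut X
  exact mul_ne_zero (mod_cast Nat.card_ne_zero.mpr ⟨⟨1⟩, this⟩) (shiftProd_ne_zero X X)

end

/-! ### Cones and cocones -/

section

variable {C : Type u} [Category.{w} C] [Preadditive C] [HasShift C ℤ] [HasZeroObject C]
  [∀ n : ℤ, (shiftFunctor C n).Additive] [Pretriangulated C]

/-- Rotation of triangles; it reduces questions about cocones to questions about cones. -/
theorem homWithCocone_eq_homWithCone_shift (X L Y : C) :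
    homWithCocone X L Y = homWithCone L Y (X⟦(1 : ℤ)⟧) := by
  ext g
  constructor
  · rintro ⟨f, h, hT⟩
    exact ⟨h, -f⟦(1 : ℤ)⟧', rot_of_distTriang _ hT⟩
  · rintro ⟨h, f', hT⟩
    refine ⟨(shiftFunctor C (1 : ℤ)).preimage (-f'), h, ?_⟩
    rw [rotate_distinguished_triangle]
    have e : -((shiftFunctor C (1 : ℤ)).preimage (-f'))⟦(1 : ℤ)⟧' = f' := by simp
    change Triangle.mk g h (-((shiftFunctor C (1 : ℤ)).preimage (-f'))⟦(1 : ℤ)⟧') ∈ distTriang C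
    rwa [e]

theorem homWithCone_subset {X L Y Y' : C} (e : Y ≅ Y') : homWithCone X L Y ⊆ homWithCone X L Y' := by
  intro f hf
  simpa using homWithCone_iso (Iso.refl X) (Iso.refl L) e hf

/-- Existence and uniqueness of cones: morphism sets are partitioned by the class of the cone. -/
theorem existsUnique_cone {X L : C} (f : X ⟶ L) :
    ∃! y : IsoClass C, f ∈ homWithCone X L y.out := by
  obtain ⟨Y, g, h, hT⟩ := distinguished_cocone_triangle f
  refine ⟨isoClass Y, ?_, fun y hy => ?_⟩
  · obtain ⟨e⟩ := Quotient.exact (Quotient.out_eq (isoClass Y))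
    exact homWithCone_subset e.symm ⟨g, h, hT⟩
  · obtain ⟨g', h', hT'⟩ := hy
    rw [← Quotient.out_eq y]
    exact Quotient.sound ⟨Triangle.π₃.mapIso (isoTriangleOfIso₁₂ _ _ hT' hT (Iso.refl X)
      (Iso.refl L) ((Category.comp_id f).trans (Category.id_comp f).symm))⟩

theorem existsUnique_cocone {L Y : C} (g : L ⟶ Y) :
    ∃! x : IsoClass C, g ∈ homWithCocone x.out L Y := by
  simp only [homWithCocone_eq_homWithCone_shift]
  obtain ⟨X, f, h, hT⟩ := distinguished_cocone_triangle₁ g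
  have hX : g ∈ homWithCone L Y (X⟦(1 : ℤ)⟧) :=
    homWithCocone_eq_homWithCone_shift X L Y ▸ ⟨f, h, hT⟩
  refine ⟨isoClass X, ?_, fun x hx => ?_⟩
  · obtain ⟨e⟩ := Quotient.exact (Quotient.out_eq (isoClass X))
    exact homWithCone_subset ((shiftFunctor C (1 : ℤ)).mapIso e.symm) hX
  · obtain ⟨g', h', hT'⟩ := hX
    obtain ⟨g'', h'', hT''⟩ := hx
    rw [← Quotient.out_eq x]
    exact Quotient.sound ⟨(shiftFunctor C (1 : ℤ)).preimageIso (Triangle.π₃.mapIso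
      (isoTriangleOfIso₁₂ _ _ hT'' hT' (Iso.refl L)
      (Iso.refl Y) ((Category.comp_id g).trans (Category.id_comp g).symm)))⟩

/-- The octahedron on `f ≫ p` has cones `L'`, `Y⟦1⟧` and `Z`, hence a triangle `L' ⟶ Z ⟶ Y⟦1⟧ ⟶
L'⟦1⟧`. Its last map is `-(i ≫ g)⟦1⟧'`, exactly the sign needed to rotate back to `Y ⟶ L' ⟶ Z`. -/
theorem comp_mem_homWithCone [IsTriangulated C] {L N L' Y M Z : C} {f : L ⟶ N} {g : N ⟶ L'}
    {h : L' ⟶ L⟦(1 : ℤ)⟧} (hT : Triangle.mk f g h ∈ distTriang C) {i : Y ⟶ N} {p : N ⟶ M}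
    {d : M ⟶ Y⟦(1 : ℤ)⟧} (hS : Triangle.mk i p d ∈ distTriang C)
    (hZ : f ≫ p ∈ homWithCone L M Z) : i ≫ g ∈ homWithCone Y L' Z := by
  obtain ⟨v, x, hT'⟩ := hZ
  have hS' : Triangle.mk p d (-i⟦(1 : ℤ)⟧') ∈ distTriang C := rot_of_distTriang _ hS
  let o := Triangulated.someOctahedron (rfl : f ≫ p = f ≫ p) hT hS' hT'
  refine ⟨o.m₁, o.m₃, (rotate_distinguished_triangle _).mpr ?_⟩
  have e : (-i⟦(1 : ℤ)⟧') ≫ g⟦(1 : ℤ)⟧' = -(i ≫ g)⟦(1 : ℤ)⟧' := by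
    rw [Functor.map_comp, Preadditive.neg_comp]
  have := o.mem
  rwa [e] at this

/-- The cones of `f ≫ p` and `i ≫ g` agree, for distinguished triangles `(f, g, h)` and
`(i, p, d)` with the same middle term. -/
theorem comp_mem_homWithCone_iff [IsTriangulated C] {L N L' Y M Z : C} {f : L ⟶ N} {g : N ⟶ L'}
    {h : L' ⟶ L⟦(1 : ℤ)⟧} (hT : Triangle.mk f g h ∈ distTriang C) {i : Y ⟶ N} {p : N ⟶ M}
    {d : M ⟶ Y⟦(1 : ℤ)⟧} (hS : Triangle.mk i p d ∈ distTriang C) :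
    f ≫ p ∈ homWithCone L M Z ↔ i ≫ g ∈ homWithCone Y L' Z :=
  ⟨comp_mem_homWithCone hT hS, comp_mem_homWithCone hS hT⟩

theorem triangle_inl_snd (M Y : C) :
    Triangle.mk (biprod.inl : M ⟶ M ⊞ Y) biprod.snd (0 : Y ⟶ M⟦(1 : ℤ)⟧) ∈ distTriang C :=
  binaryBiproductTriangle_distinguished M Y

theorem triangle_inr_fst (M Y : C) :
    Triangle.mk (biprod.inr : Y ⟶ M ⊞ Y) biprod.fst (0 : M ⟶ Y⟦(1 : ℤ)⟧) ∈ distTriang C := by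
  refine isomorphic_distinguished _ (triangle_inl_snd Y M) _
    (Triangle.isoMk _ _ (Iso.refl Y) (biprod.braiding M Y) (Iso.refl M) ?_ ?_ ?_)
  · change biprod.inr ≫ (biprod.braiding M Y).hom = 𝟙 Y ≫ biprod.inl
    apply biprod.hom_ext <;> simp
  · change biprod.fst ≫ 𝟙 M = (biprod.braiding M Y).hom ≫ biprod.snd
    simp
  · exact zero_comp.trans comp_zero.symm

/-! ### Hall numbers -/

theorem hallCoeff_isoClass_out (X Y : C) (l : IsoClass C) :
    hallCoeff (isoClass X) (isoClass Y) l = hallNumber X Y l.out := by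
  rw [← hallCoeff_isoClass, isoClass_out]

theorem hallCoeff_out_isoClass (l : IsoClass C) (Z M : C) :
    hallCoeff l (isoClass Z) (isoClass M) = hallNumber l.out Z M := by
  rw [← hallCoeff_isoClass, isoClass_out]

theorem hallCoeff_isoClass_out_isoClass (X : C) (l : IsoClass C) (M : C) :
    hallCoeff (isoClass X) l (isoClass M) = hallNumber X l.out M := by
  rw [← hallCoeff_isoClass, isoClass_out]

theorem shiftProd_biprod_right (hfin : ∀ X Y : C, {i : ℤ | Nontrivial (X⟦i⟧ ⟶ Y)}.Finite)
    (L M Y : C) : shiftProd L (M ⊞ Y) = shiftProd L M * shiftProd L Y := by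
  rw [shiftProd_eq_altProd, shiftProd_eq_altProd, shiftProd_eq_altProd, ← altProd_mul
    ((eventually_card_shift hfin L M).mono fun i hi => by rw [hi, Nat.cast_one])
    ((eventually_card_shift hfin L Y).mono fun i hi => by rw [hi, Nat.cast_one])]
  refine congrArg altProd (funext fun n => ?_)
  rw [← Nat.cast_mul, ← Nat.card_prod]
  exact congrArg _ (Nat.card_congr
    { toFun := fun u => (u ≫ biprod.fst, u ≫ biprod.snd)
      invFun := fun u => biprod.lift u.1 u.2
      left_inv := fun u => by ext <;> simp
      right_inv := fun u => by simp })

theorem shiftProd_biprod_left (hfin : ∀ X Y : C, {i : ℤ | Nontrivial (X⟦i⟧ ⟶ Y)}.Finite)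
    (M Y L : C) : shiftProd (M ⊞ Y) L = shiftProd M L * shiftProd Y L := by
  have ev (A : C) : ∀ᶠ n : ℕ in Filter.atTop, (Nat.card (A ⟶ L⟦-((n : ℤ) + 1)⟧) : ℚ) = 1 := by
    filter_upwards [eventually_card_shift hfin A L] with n hn
    rw [← Nat.card_congr (shiftHomEquiv A L n), hn, Nat.cast_one]
  rw [shiftProd_eq_altProd_right, shiftProd_eq_altProd_right, shiftProd_eq_altProd_right,
    ← altProd_mul (ev M) (ev Y)]
  refine congrArg altProd (funext fun n => ?_)
  rw [← Nat.cast_mul, ← Nat.card_prod]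
  exact congrArg _ (Nat.card_congr
    { toFun := fun u => (biprod.inl ≫ u, biprod.inr ≫ u)
      invFun := fun u => biprod.desc u.1 u.2
      left_inv := fun u => by ext <;> simp
      right_inv := fun u => by simp })

theorem hallNumber_eq (X Y L : C) :
    hallNumber X Y L = Nat.card (homWithCone X L Y) * shiftProd X L / autWeight X := by
  rw [hallNumber, autWeight, div_mul_div_comm]

variable [∀ X Y : C, Finite (X ⟶ Y)]

theorem hallNumber_eq_cocone (hfin : ∀ X Y : C, {i : ℤ | Nontrivial (X⟦i⟧ ⟶ Y)}.Finite)
    (X Y L : C) :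
    hallNumber X Y L = Nat.card (homWithCocone X L Y) * shiftProd L Y / autWeight Y := by
  have h := card_homWithCone_symm hfin (X := X) (Y := L) (Z := Y) Set.univ Set.univ
    fun _ _ _ _ => Iff.rfl
  rw [Set.univ_inter, Set.univ_inter] at h
  rw [hallNumber_eq, div_eq_div_iff (autWeight_ne_zero X) (autWeight_ne_zero Y)]
  unfold autWeight
  linear_combination h

theorem hallNumber_ne_zero {X Y L : C} {f : X ⟶ L} (hf : f ∈ homWithCone X L Y) :
    hallNumber X Y L ≠ 0 := by
  rw [hallNumber_eq]
  exact div_ne_zero (mul_ne_zero (mod_cast Nat.card_ne_zero.mpr ⟨⟨f, hf⟩, inferInstance⟩)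
    (shiftProd_ne_zero X L)) (autWeight_ne_zero X)

theorem hallNumber_ne_zero_of_cocone {X Y L : C} {g : L ⟶ Y} (hg : g ∈ homWithCocone X L Y) :
    hallNumber X Y L ≠ 0 := by
  obtain ⟨f, h, hT⟩ := hg
  exact hallNumber_ne_zero ⟨g, h, hT⟩

/-- The first factor is taken in cocone form and the second in cone form, so both count morphisms
out of `L`; a pair of them is one morphism to `M ⊞ Y`. -/
theorem hallNumber_mul_hallNumber_left
    (hfin : ∀ X Y : C, {i : ℤ | Nontrivial (X⟦i⟧ ⟶ Y)}.Finite) (X Y Z M L : C) :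
    hallNumber X Y L * hallNumber L Z M =
      Nat.card {u : L ⟶ M ⊞ Y | u ≫ biprod.fst ∈ homWithCone L M Z ∧
        u ≫ biprod.snd ∈ homWithCocone X L Y} *
      (shiftProd L (M ⊞ Y) / (autWeight L * autWeight Y)) := by
  have e : Nat.card {u : L ⟶ M ⊞ Y | u ≫ biprod.fst ∈ homWithCone L M Z ∧
      u ≫ biprod.snd ∈ homWithCocone X L Y} =
      Nat.card (homWithCone L M Z) * Nat.card (homWithCocone X L Y) := by
    rw [← Nat.card_prod]
    exact Nat.card_congr
      { toFun := fun u => (⟨_, u.2.1⟩, ⟨_, u.2.2⟩)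
        invFun := fun v => ⟨biprod.lift v.1.1 v.2.1, by simp⟩
        left_inv := fun u => by ext <;> simp
        right_inv := fun v => by simp }
  rw [e, hallNumber_eq_cocone hfin X Y L, hallNumber_eq, shiftProd_biprod_right hfin]
  push_cast
  ring

theorem hallNumber_mul_hallNumber_right
    (hfin : ∀ X Y : C, {i : ℤ | Nontrivial (X⟦i⟧ ⟶ Y)}.Finite) (X Y Z M L : C) :
    hallNumber Y Z L * hallNumber X L M =
      Nat.card {v : M ⊞ Y ⟶ L | biprod.inr ≫ v ∈ homWithCone Y L Z ∧
        biprod.inl ≫ v ∈ homWithCocone X M L} *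
      (shiftProd (M ⊞ Y) L / (autWeight L * autWeight Y)) := by
  have e : Nat.card {v : M ⊞ Y ⟶ L | biprod.inr ≫ v ∈ homWithCone Y L Z ∧
      biprod.inl ≫ v ∈ homWithCocone X M L} =
      Nat.card (homWithCone Y L Z) * Nat.card (homWithCocone X M L) := by
    rw [← Nat.card_prod]
    exact Nat.card_congr
      { toFun := fun u => (⟨_, u.2.1⟩, ⟨_, u.2.2⟩)
        invFun := fun v => ⟨biprod.desc v.2.1 v.1.1, by simp⟩
        left_inv := fun u => by ext <;> simp
        right_inv := fun v => by simp }
  rw [e, hallNumber_eq_cocone hfin X L M, hallNumber_eq, shiftProd_biprod_left hfin]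
  push_cast
  ring

/-- Both sides become sums over pairs `(l, l')`, indexed by triangles `l ⟶ M ⊞ Y ⟶ l'`, and agree
term by term. -/
theorem hallCoeff_assoc [IsTriangulated C]
    (hfin : ∀ X Y : C, {i : ℤ | Nontrivial (X⟦i⟧ ⟶ Y)}.Finite) (x y z m : IsoClass C)
    (s t : Finset (IsoClass C)) (hs : Function.support (hallCoeff x y) ⊆ s)
    (ht : Function.support (hallCoeff y z) ⊆ t) :
    ∑ l ∈ s, hallCoeff x y l * hallCoeff l z m = ∑ l ∈ t, hallCoeff y z l * hallCoeff x l m := by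
  induction x, y using Quotient.inductionOn₂ with | _ X Y => ?_
  induction z, m using Quotient.inductionOn₂ with | _ Z M => ?_
  let G (L : C) : Set (L ⟶ M ⊞ Y) := {u | u ≫ biprod.fst ∈ homWithCone L M Z ∧
    u ≫ biprod.snd ∈ homWithCocone X L Y}
  let G' (L : C) : Set (M ⊞ Y ⟶ L) := {v | biprod.inr ≫ v ∈ homWithCone Y L Z ∧
    biprod.inl ≫ v ∈ homWithCocone X M L}
  -- The octahedral comparison is used twice, with the split triangles `Y ⟶ M ⊞ Y ⟶ M` and `M ⟶ M ⊞
  -- Y ⟶ Y`.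
  have hG (L L' : C) (u : L ⟶ M ⊞ Y) (v : M ⊞ Y ⟶ L') (h : L' ⟶ L⟦(1 : ℤ)⟧)
      (hT : Triangle.mk u v h ∈ distTriang C) : u ∈ G L ↔ v ∈ G' L' := by
    refine and_congr (comp_mem_homWithCone_iff hT (triangle_inr_fst M Y)) ?_
    rw [homWithCocone_eq_homWithCone_shift, homWithCocone_eq_homWithCone_shift]
    exact comp_mem_homWithCone_iff hT (triangle_inl_snd M Y)
  have hl (l : IsoClass C) : hallCoeff (isoClass X) (isoClass Y) l *
      hallCoeff l (isoClass Z) (isoClass M) = ∑ l' ∈ t,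
        (Nat.card ↥(G l.out ∩ homWithCone l.out (M ⊞ Y) l'.out) : ℚ) *
          (shiftProd l.out (M ⊞ Y) / (autWeight l.out * autWeight Y)) := by
    have := sum_card_inter (G l.out) (fun l' : IsoClass C => homWithCone l.out (M ⊞ Y) l'.out) t
      (fun u _ => existsUnique_cone u) (by
        rintro l' ⟨u, hu, v, h, hT⟩
        -- If `l'` is the cone of some `u` in `G`, then `Z` is the cone of a map `Y ⟶ l'`, so
        -- `F_{YZ}^{l'}` is nonzero.
        refine ht ?_
        rw [Function.mem_support, hallCoeff_isoClass_out]
        exact hallNumber_ne_zero ((hG _ _ _ _ _ hT).mp hu).1)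
    rw [← Finset.sum_mul, ← Nat.cast_sum, this, ← hallNumber_mul_hallNumber_left hfin X Y Z M l.out,
      hallCoeff_isoClass_out, hallCoeff_out_isoClass]
  have hl' (l' : IsoClass C) : hallCoeff (isoClass Y) (isoClass Z) l' *
      hallCoeff (isoClass X) l' (isoClass M) = ∑ l ∈ s,
        (Nat.card ↥(G' l'.out ∩ homWithCocone l.out (M ⊞ Y) l'.out) : ℚ) *
          (shiftProd (M ⊞ Y) l'.out / (autWeight l'.out * autWeight Y)) := by
    have := sum_card_inter (G' l'.out) (fun l : IsoClass C => homWithCocone l.out (M ⊞ Y) l'.out) s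
      (fun v _ => existsUnique_cocone v) (by
        rintro l ⟨v, hv, u, h, hT⟩
        refine hs ?_
        rw [Function.mem_support, hallCoeff_isoClass_out]
        exact hallNumber_ne_zero_of_cocone ((hG _ _ _ _ _ hT).mpr hv).2)
    rw [← Finset.sum_mul, ← Nat.cast_sum, this,
      ← hallNumber_mul_hallNumber_right hfin X Y Z M l'.out,
      hallCoeff_isoClass_out, hallCoeff_isoClass_out_isoClass]
  refine (Finset.sum_congr rfl fun l _ => hl l).trans
    (Eq.trans ?_ (Finset.sum_congr rfl fun l _ => hl' l).symm)
  rw [Finset.sum_comm]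
  refine Finset.sum_congr rfl fun l' _ => Finset.sum_congr rfl fun l _ => ?_
  have h := card_homWithCone_symm hfin (G l.out) (G' l'.out) (hG l.out l'.out)
  rw [← mul_div_assoc, ← mul_div_assoc,
    div_eq_div_iff (mul_ne_zero (autWeight_ne_zero _) (autWeight_ne_zero _))
      (mul_ne_zero (autWeight_ne_zero _) (autWeight_ne_zero _))]
  unfold autWeight
  linear_combination (Nat.card (Aut Y) * shiftProd Y Y) * h

end

/-! ### Hall numbers with the zero object -/

section

variable {C : Type u} [Category.{w} C] [HasShift C ℤ] [HasZeroObject C]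

theorem shiftProd_zero_right (X : C) : shiftProd X 0 = 1 := by
  refine finprod_eq_one_of_forall_eq_one fun n => ?_
  rw [Nat.card_unique, Nat.cast_one, one_zpow]

variable [Preadditive C] [∀ n : ℤ, (shiftFunctor C n).Additive]

theorem shiftProd_zero_left (Y : C) : shiftProd 0 Y = 1 := by
  refine finprod_eq_one_of_forall_eq_one fun n => ?_
  have hz : IsZero ((0 : C)⟦(n : ℤ) + 1⟧) := (shiftFunctor C _).map_isZero (isZero_zero C)
  have : Unique ((0 : C)⟦(n : ℤ) + 1⟧ ⟶ Y) := (hz.unique_to Y).some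
  rw [Nat.card_unique, Nat.cast_one, one_zpow]

theorem autWeight_zero : autWeight (0 : C) = 1 := by
  have : Subsingleton (Aut (0 : C)) := ⟨fun a b => Iso.ext ((isZero_zero C).eq_of_src _ _)⟩
  rw [autWeight, shiftProd_zero_left, Nat.card_unique, Nat.cast_one, one_mul]

variable [Pretriangulated C]

theorem exists_triangle_of_hallNumber_ne_zero {X Y L : C} (h : hallNumber X Y L ≠ 0) :
    ∃ (f : X ⟶ L) (g : L ⟶ Y) (d : Y ⟶ X⟦(1 : ℤ)⟧), Triangle.mk f g d ∈ distTriang C := by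
  have h1 : Nat.card (homWithCone X L Y) ≠ 0 := fun h0 => h (by simp [hallNumber, h0])
  obtain ⟨⟨f, g, d, hT⟩⟩ := (Nat.card_ne_zero.mp h1).1
  exact ⟨f, g, d, hT⟩

/-- This makes the twisting exponent the same for all terms of a Hall product. -/
theorem toK0_eq_add {x y l : IsoClass C} (h : hallCoeff x y l ≠ 0) :
    l.toK0 = x.toK0 + y.toK0 := by
  induction x, y using Quotient.inductionOn₂ with | _ X Y => ?_
  induction l using Quotient.inductionOn with | _ L => ?_
  obtain ⟨f, g, d, hT⟩ := exists_triangle_of_hallNumber_ne_zero (X := X) (Y := Y) (L := L) h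
  exact k0Class_triangle _ hT

theorem toK0_zero : (isoClass (0 : C)).toK0 = 0 := k0Class_zero

theorem hallNumber_zero_left (Y : C) : hallNumber 0 Y Y = 1 := by
  have : Unique (homWithCone 0 Y Y) :=
    { default := ⟨0, 𝟙 Y, 0, contractible_distinguished₁ Y⟩
      uniq := fun f => Subtype.ext ((isZero_zero C).eq_of_src _ _) }
  rw [hallNumber_eq, autWeight_zero, shiftProd_zero_left, Nat.card_unique]
  simp

open Classical in
theorem hallCoeff_zero_left (y l : IsoClass C) :
    hallCoeff (isoClass 0) y l = if l = y then 1 else 0 := by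
  induction y, l using Quotient.inductionOn₂ with | _ Y L => ?_
  split_ifs with h
  · rw [h]
    exact hallNumber_zero_left Y
  · by_contra hne
    obtain ⟨f, g, d, hT⟩ := exists_triangle_of_hallNumber_ne_zero (X := 0) (Y := Y) (L := L) hne
    have : IsIso g := (Triangle.isZero₁_iff_isIso₂ _ hT).mp (isZero_zero C)
    exact h (Quotient.sound ⟨asIso g⟩)

variable [∀ X Y : C, Finite (X ⟶ Y)]

/-- In cocone form only the single map `X ⟶ 0` has to be counted. -/
theorem hallNumber_zero_right (hfin : ∀ X Y : C, {i : ℤ | Nontrivial (X⟦i⟧ ⟶ Y)}.Finite) (X : C) :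
    hallNumber X 0 X = 1 := by
  have : Unique (homWithCocone X X 0) :=
    { default := ⟨0, 𝟙 X, 0, contractible_distinguished X⟩
      uniq := fun f => Subtype.ext ((isZero_zero C).eq_of_tgt _ _) }
  rw [hallNumber_eq_cocone hfin, autWeight_zero, shiftProd_zero_right, Nat.card_unique]
  simp

open Classical in
theorem hallCoeff_zero_right (hfin : ∀ X Y : C, {i : ℤ | Nontrivial (X⟦i⟧ ⟶ Y)}.Finite)
    (x l : IsoClass C) : hallCoeff x (isoClass 0) l = if l = x then 1 else 0 := by
  induction x, l using Quotient.inductionOn₂ with | _ X L => ?_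
  split_ifs with h
  · rw [h]
    exact hallNumber_zero_right hfin X
  · by_contra hne
    obtain ⟨f, g, d, hT⟩ := exists_triangle_of_hallNumber_ne_zero (X := X) (Y := 0) (L := L) hne
    have : IsIso f := (Triangle.isZero₃_iff_isIso₁ _ hT).mp (isZero_zero C)
    exact h (Quotient.sound ⟨(asIso f).symm⟩)

end

/-! ### Bilinear multiplications determined on a basis -/

section

variable {R M ι : Type*} [CommRing R] [AddCommGroup M] [Module R M] (B : Module.Basis ι R M)
  (m : M →ₗ[R] M →ₗ[R] M)

theorem basis_left_unit (e : M) (h : ∀ i, m e (B i) = B i) (a : M) : m e a = a :=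
  LinearMap.congr_fun (B.ext h : m e = LinearMap.id) a

theorem basis_right_unit (e : M) (h : ∀ i, m (B i) e = B i) (a : M) : m a e = a :=
  LinearMap.congr_fun (B.ext h : m.flip e = LinearMap.id) a

theorem basis_assoc (h : ∀ i j l, m (m (B i) (B j)) (B l) = m (B i) (m (B j) (B l)))
    (a b c : M) : m (m a b) c = m a (m b c) := by
  -- The two sides are `(a, b) ↦ m (m a b)` and `(a, b) ↦ m a ∘ m b`.
  have h1 : m.compr₂ m = (LinearMap.llcomp R M M M).compl₁₂ m m :=
    B.ext fun i => B.ext fun j => B.ext fun l => h i j l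
  exact congrArg (fun f => f a b c) h1

end

/-! ### The algebra -/

theorem Qv.v_ne_zero (k : Type*) [Nonempty k] [Finite k] : Qv.v k ≠ 0 := by
  intro h
  have h1 : Real.sqrt (Nat.card k) = 0 := congrArg Subtype.val h
  have h2 : (0 : ℝ) < Nat.card k := mod_cast Nat.card_pos
  exact (Real.sqrt_pos.mpr h2).ne' h1

namespace Het

variable {k : Type*} [Field k] [Finite k] {C : Type u} [Category.{w} C] [Preadditive C]
  [Linear k C] [HasZeroObject C] [HasShift C ℤ] [∀ n : ℤ, (shiftFunctor C n).Additive]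
  [Pretriangulated C] [HomologicallyFinite k C]

open Classical in
theorem repr_hallProduct (c d : K0 C) (x y m : IsoClass C) :
    (basis k C).repr (hallProduct k c x y) (d, m) =
      if c = d then algebraMap ℚ (Qv k) (hallCoeff x y m) else 0 := by
  have h (l : IsoClass C) : (basis k C).repr (Ku k c l) (d, m) =
      if l = m then (if c = d then 1 else 0) else 0 := by
    rw [Ku, Module.Basis.repr_self, Finsupp.single_apply]
    simp only [Prod.mk.injEq, ← ite_and]
    exact if_congr and_comm rfl rfl
  rw [hallProduct, map_sum, Finsupp.finsetSum_apply]
  simp only [map_smul, Finsupp.smul_apply, h, smul_eq_mul, mul_ite, mul_one, mul_zero]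
  rw [Finset.sum_ite_eq']
  simp only [Set.Finite.mem_toFinset, Function.mem_support]
  split_ifs with h1 h2 h2 <;> simp_all

theorem hallProduct_eq_Ku {c : K0 C} {x y z : IsoClass C}
    (h : ∀ l, hallCoeff x y l = open Classical in if l = z then 1 else 0) :
    hallProduct k c x y = Ku k c z := by
  classical
  refine (basis k C).repr.injective (Finsupp.ext fun ⟨d, m⟩ => ?_)
  rw [repr_hallProduct, h, Ku, Module.Basis.repr_self, Finsupp.single_apply]
  simp only [Prod.mk.injEq]
  by_cases hc : c = d <;> by_cases hm : m = z
  · simp [hc, hm]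
  · simp [hm, Ne.symm hm]
  · simp [hc]
  · simp [hc]

theorem hallProduct_assoc [IsTriangulated C] (c : K0 C) (x y z : IsoClass C) :
    ∑ l ∈ (hallCoeff_support_finite k x y).toFinset,
        algebraMap ℚ (Qv k) (hallCoeff x y l) • hallProduct k c l z =
      ∑ l ∈ (hallCoeff_support_finite k y z).toFinset,
        algebraMap ℚ (Qv k) (hallCoeff y z l) • hallProduct k c x l := by
  classical
  have (X Y : C) : Finite (X ⟶ Y) :=
    have : Module.Finite k (X ⟶ Y) := HomologicallyFinite.finite_hom X Y
    Module.finite_of_finite k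
  refine (basis k C).repr.injective (Finsupp.ext fun ⟨d, m⟩ => ?_)
  simp only [map_sum, Finsupp.finsetSum_apply, map_smul, Finsupp.smul_apply, repr_hallProduct,
    smul_eq_mul, mul_ite, mul_zero]
  split_ifs with h
  · simp only [← map_mul]
    rw [← map_sum, ← map_sum, hallCoeff_assoc (HomologicallyFinite.finite_shifts k) x y z m _ _
      (Set.Finite.coe_toFinset _).ge (Set.Finite.coe_toFinset _).ge]
  · simp

variable [∀ n : ℤ, Functor.Linear k (shiftFunctor C n)]

theorem Ku_mul_Ku_eq_hallProduct (a b : K0 C) (x y : IsoClass C) :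
    Ku k a x * Ku k b y = Qv.v k ^ (eulerForm k C x.toK0 y.toK0 - symEulerForm k C b x.toK0) •
      hallProduct k (a + b) x y := by
  rw [mul_def, mulMap, Ku, Ku, Module.Basis.constr_basis, Module.Basis.constr_basis]

theorem hallProduct_mul_Ku (a b : K0 C) (x y z : IsoClass C) :
    hallProduct k a x y * Ku k b z =
      Qv.v k ^ (eulerForm k C (x.toK0 + y.toK0) z.toK0 - symEulerForm k C b (x.toK0 + y.toK0)) •
        ∑ l ∈ (hallCoeff_support_finite k x y).toFinset,
          algebraMap ℚ (Qv k) (hallCoeff x y l) • hallProduct k (a + b) l z := by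
  rw [mul_def, hallProduct, map_sum, LinearMap.sum_apply, Finset.smul_sum]
  refine Finset.sum_congr rfl fun l hl => ?_
  rw [map_smul, LinearMap.smul_apply, ← mul_def, Ku_mul_Ku_eq_hallProduct, smul_comm,
    toK0_eq_add ((Set.Finite.mem_toFinset _).mp hl)]

theorem Ku_mul_hallProduct (a b : K0 C) (x y z : IsoClass C) :
    Ku k a x * hallProduct k b y z =
      Qv.v k ^ (eulerForm k C x.toK0 (y.toK0 + z.toK0) - symEulerForm k C b x.toK0) •
        ∑ l ∈ (hallCoeff_support_finite k y z).toFinset,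
          algebraMap ℚ (Qv k) (hallCoeff y z l) • hallProduct k (a + b) x l := by
  rw [mul_def, hallProduct, map_sum, Finset.smul_sum]
  refine Finset.sum_congr rfl fun l hl => ?_
  rw [map_smul, ← mul_def, Ku_mul_Ku_eq_hallProduct, smul_comm,
    toK0_eq_add ((Set.Finite.mem_toFinset _).mp hl)]

theorem Ku_mul_Ku_mul_Ku [IsTriangulated C] (a b c : K0 C) (x y z : IsoClass C) :
    Ku k a x * Ku k b y * Ku k c z = Ku k a x * (Ku k b y * Ku k c z) := by
  have hv := Qv.v_ne_zero k
  rw [Ku_mul_Ku_eq_hallProduct, Ku_mul_Ku_eq_hallProduct b c, mul_def, map_smul,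
    LinearMap.smul_apply, ← mul_def, mul_def k (Ku k a x), map_smul, ← mul_def, hallProduct_mul_Ku, Ku_mul_hallProduct,
    hallProduct_assoc, smul_smul, smul_smul, ← zpow_add₀ hv, ← zpow_add₀ hv, add_assoc]
  congr 2
  -- Both exponents equal `⟨x, y⟩ + ⟨x, z⟩ + ⟨y, z⟩ - (b, x) - (c, x) - (c, y)`.
  simp only [symEulerForm, map_add, AddMonoidHom.add_apply]
  ring

theorem Ku_zero_mul_Ku (b : K0 C) (y : IsoClass C) :
    Ku k 0 (isoClass 0) * Ku k b y = Ku k b y := by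
  rw [Ku_mul_Ku_eq_hallProduct, hallProduct_eq_Ku (hallCoeff_zero_left y), toK0_zero]
  simp [symEulerForm]

theorem Ku_mul_Ku_zero (a : K0 C) (x : IsoClass C) :
    Ku k a x * Ku k 0 (isoClass 0) = Ku k a x := by
  have (X Y : C) : Finite (X ⟶ Y) :=
    have : Module.Finite k (X ⟶ Y) := HomologicallyFinite.finite_hom X Y
    Module.finite_of_finite k
  rw [Ku_mul_Ku_eq_hallProduct, hallProduct_eq_Ku
    (hallCoeff_zero_right (HomologicallyFinite.finite_shifts k) x), toK0_zero]
  simp [symEulerForm]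

theorem Ku_zero_mul (a : Het k C) : Ku k 0 (isoClass 0) * a = a :=
  basis_left_unit (basis k C) (mulMap k C) _ (fun i => Ku_zero_mul_Ku i.1 i.2) a

theorem mul_Ku_zero (a : Het k C) : a * Ku k 0 (isoClass 0) = a :=
  basis_right_unit (basis k C) (mulMap k C) _ (fun i => Ku_mul_Ku_zero i.1 i.2) a

theorem mul_assoc_of_isTriangulated [IsTriangulated C] (a b c : Het k C) :
    a * b * c = a * (b * c) :=
  basis_assoc (basis k C) (mulMap k C)
    (fun i j l => Ku_mul_Ku_mul_Ku i.1 j.1 l.1 i.2 j.2 l.2) a b c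

end Het

end DerivedHall

theorem mainTheorem10 {k : Type*} [Field k] [Finite k] {C : Type*} [Category* C] [Preadditive C]
    [Linear k C] [HasZeroObject C] [HasShift C ℤ] [∀ n : ℤ, (shiftFunctor C n).Additive]
    [∀ n : ℤ, Functor.Linear k (shiftFunctor C n)] [Pretriangulated C] [IsTriangulated C]
    [DerivedHall.HomologicallyFinite k C] :
    (∀ (α β : DerivedHall.K0 C) (x y : DerivedHall.IsoClass C),
      DerivedHall.Het.Ku k α x * DerivedHall.Het.Ku k β y =
        DerivedHall.Qv.v k ^ (DerivedHall.eulerForm k C x.toK0 y.toK0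
            - DerivedHall.symEulerForm k C β x.toK0) •
          ∑ᶠ l : DerivedHall.IsoClass C,
            algebraMap ℚ (DerivedHall.Qv k) (DerivedHall.hallCoeff x y l) •
              DerivedHall.Het.Ku k (α + β) l) ∧
    (∀ a : DerivedHall.Het k C,
      DerivedHall.Het.Ku k 0 (DerivedHall.isoClass 0) * a = a ∧
        a * DerivedHall.Het.Ku k 0 (DerivedHall.isoClass 0) = a) ∧
    ∀ a b c : DerivedHall.Het k C, (a * b) * c = a * (b * c) :=
  ⟨DerivedHall.Het.Ku_mul_Ku k, fun a => ⟨DerivedHall.Het.Ku_zero_mul a,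
    DerivedHall.Het.mul_Ku_zero a⟩, DerivedHall.Het.mul_assoc_of_isTriangulated⟩
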